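/- Let $k$ be a field and let $m\ge 0$. For a partition $\lambda$ of $n$ let $S^\lambda$ be the Specht module of the symmetric group $S_n$ over $k$ (the span of the polytabloids of shape $\lambda$). Let $\mu^1>\mu^2>\cdots>\mu^r$ be all the partitions of $m$ in decreasing lexicographic order. For an $r$-multipartition $\underline{\nu}=(\nu^1,\dots,\nu^r)$ of $n$ (an $r$-tuple of partitions with $\sum_i|\nu^i|=n$) put $\gamma=(|\nu^1|,\dots,|\nu^r|)$, let $S_\gamma\cong S_{\gamma_1}\times\cdots\times S_{\gamma_r}$ be the corresponding Young subgroup of $S_n$, and let $S_m\wr S_\gamma\le S_m\wr S_n$ be the subgroup of elements $(\sigma;\alpha_1,\dots,\alpha_n)$ with $\sigma\in S_\gamma$. The Specht module $S^{\underline{\nu}}$ of $k(S_m\wr S_n)$ is the module induced from $S_m\wr S_\gamma$ to $S_m\wr S_n$ from the $k(S_m\wr S_\gamma)$-module \[ (S^{\mu^1})^{\otimes\gamma_1}\otimes\cdots\otimes(S^{\mu^r})^{\otimes\gamma_r}\otimes\bigl(S^{\nu^1}\otimes\cdots\otimes S^{\nu^r}\bigr), \] with the (right) action $(x_1\otimes\cdots\otimes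 x_n\otimes y)(\sigma;\alpha_1,\dots,\alpha_n)=x_{(1)\sigma^{-1}}\alpha_1\otimes\cdots\otimes x_{(n)\sigma^{-1}}\alpha_n\otimes y\sigma$. For $n>0$ embed $S_m\wr S_{n-1}$ in $S_m\wr S_n$ by $(\sigma;\alpha_1,\dots,\alpha_{n-1})\mapsto(\sigma;\alpha_1,\dots,\alpha_{n-1},e)$, where $S_{n-1}$ is the subgroup of $S_n$ fixing $n$. Theorem. Let $n>0$ and let $\underline{\lambda}=(\lambda^1,\dots,\lambda^r)$ be an $r$-multipartition of $n$. Then the restriction $M$ of $S^{\underline{\lambda}}$ from $k(S_m\wr S_n)$ to $k(S_m\wr S_{n-1})$ has a filtration by Specht modules: there are a chain of submodules $0=M_0\subseteq M_1\subseteq\cdots\subseteq M_N=M$ and a function $f$ from $\{1,\dots,N\}$ to the set of $r$-multipartitions of $n-1$ such that $M_l/M_{l-1}\cong S^{f(l)}$ for every $l$, and such that for every $r$-multipartition $\underline{\delta}$ of $n-1$ the multiplicity $|f^{-1}(\underline{\delta})|$ of $S^{\underline{\delta}}$ is equal to $\dim_k S^{\mu^i}$ if $\underline{\delta}$ is obtained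 from $\underline{\lambda}$ by removing a single box from the component $\lambda^i$ for some $i$ and leaving all the other components unchanged, and is equal to $0$ if $\underline{\delta}$ does not arise in this way for any $i$. -/

import Mathlib

noncomputable section

open scoped TensorProduct

namespace WreathSpecht

universe u v w

/-! ### Filtrations of modules over a group algebra -/

section Filtrations

variable {k : Type u} [Field k] {G : Type v} [Group G]
  {V : Type w} [AddCommGroup V] [Module k V] {ρ : Representation k G V}

/-- The action of `G` on the quotient `N / (N' ∩ N)` for submodules `N'`, `N` of a `kG`-module;
when `N' ≤ N` this is the quotient module `N / N'`. -/
def sectionRep (N' N : Subrepresentation ρ) :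
    Representation k G (N.toSubmodule ⧸ N'.toSubmodule.submoduleOf N.toSubmodule) :=
  N.toRepresentation.quotient (N'.toSubmodule.submoduleOf N.toSubmodule)
    (fun g _ hx => N'.apply_mem_toSubmodule g hx)

variable (ρ)

/-- A filtration of the `kG`-module `ρ` by the family of `kG`-modules `σ i`: a finite chain of
submodules `0 = M 0 ≤ M 1 ≤ ⋯ ≤ M length` with `M length` the whole module, and a labelling `f` of
the layers such that the layer `M (l + 1) / M l` is isomorphic to `σ (f l)`. -/
structure Filtration {ι : Type*} {W : ι → Type*} [∀ i, AddCommGroup (W i)] [∀ i, Module k (W i)]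
    (σ : ∀ i, Representation k G (W i)) where
  length : ℕ
  M : Fin (length + 1) → Subrepresentation ρ
  bottom : (M 0).toSubmodule = ⊥
  top : (M (Fin.last length)).toSubmodule = ⊤
  mono : Monotone M
  f : Fin length → ι
  layer : ∀ l : Fin length, Nonempty ((sectionRep (M l.castSucc) (M l.succ)).Equiv (σ (f l)))

variable {ρ}

/-- The multiplicity of `σ i` in a filtration: the number of layers labelled `i`. -/
def Filtration.multiplicity {ι : Type*} {W : ι → Type*} [∀ i, AddCommGroup (W i)]
    [∀ i, Module k (W i)] {σ : ∀ i, Representation k G (W i)} (Φ : Filtration ρ σ) (i : ι) : ℕ :=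
  Nat.card {l : Fin Φ.length // Φ.f l = i}

end Filtrations

/-! ### Specht modules of symmetric groups

`Equiv.Perm X` multiplies permutations from right to left, so a left module over it is the same
thing as a right module over the symmetric group whose product is composition from left to right,
with the same action of every permutation. -/

section Specht

variable (X : Type*) [Fintype X] (lam : YoungDiagram)

/-- A tableau of shape `lam`: a bijective filling of the boxes with the elements of `X`. -/
abbrev Tableau := {c // c ∈ lam.cells} ≃ X

/-- A tabloid of shape `lam`: a row-equivalence class of tableaux, given by the row in which each
element of `X` lies, so that the row `i` receives exactly `lam.rowLen i` elements. -/
abbrev Tabloid := {r : X → ℕ // ∀ i, (Finset.univ.filter fun x => r x = i).card = lam.rowLen i}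

variable {X lam}

/-- The row of the box of `t` containing `x`. -/
def Tableau.rowOf (t : Tableau X lam) (x : X) : ℕ := (t.symm x).1.1

/-- The column of the box of `t` containing `x`. -/
def Tableau.colOf (t : Tableau X lam) (x : X) : ℕ := (t.symm x).1.2

/-- The tabloid of a tableau. -/
def Tableau.tabloid (t : Tableau X lam) : Tabloid X lam :=
  ⟨t.rowOf, fun i => by
    rw [YoungDiagram.rowLen_eq_card]
    refine Finset.card_bij' (fun x _ => (t.symm x).1)
      (fun c hc => t ⟨c, (YoungDiagram.mem_row_iff.1 hc).1⟩) ?_ ?_ ?_ ?_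
    · intro x hx
      exact YoungDiagram.mem_row_iff.2 ⟨(t.symm x).2, (Finset.mem_filter.1 hx).2⟩
    · intro c hc
      exact Finset.mem_filter.2 ⟨Finset.mem_univ _, by
        simpa [Tableau.rowOf] using (YoungDiagram.mem_row_iff.1 hc).2⟩
    · intro x hx
      simp
    · intro c hc
      simp⟩

/-- The symmetric group on `X` permutes the tabloids by permuting the entries. -/
instance : MulAction (Equiv.Perm X) (Tabloid X lam) where
  smul σ T := ⟨fun x => T.1 (σ⁻¹ x), fun i => by
    rw [← T.2 i]
    exact Finset.card_bij' (fun x _ => σ⁻¹ x) (fun x _ => σ x) (by simp) (by simp) (by simp)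
      (by simp)⟩
  one_smul T := rfl
  mul_smul σ τ T := Subtype.ext (funext fun x => congrArg T.1 (by simp))

lemma smul_tabloid (σ : Equiv.Perm X) (t : Tableau X lam) :
    σ • t.tabloid = Tableau.tabloid (t.trans σ) := rfl

variable [DecidableEq X]

/-- The column stabiliser of a tableau. -/
def Tableau.colStab (t : Tableau X lam) : Finset (Equiv.Perm X) :=
  Finset.univ.filter fun π => ∀ x, t.colOf (π x) = t.colOf x

/-- The polytabloid `e_t = ∑ sgn(π) {t}π`, summed over the column stabiliser of `t`. -/
def polytabloid (k : Type*) [Field k] (t : Tableau X lam) : MonoidAlgebra k (Tabloid X lam) :=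
  ∑ π ∈ t.colStab,
    MonoidAlgebra.single (π • t.tabloid) (((Equiv.Perm.sign π : ℤˣ) : ℤ) : k)

lemma ofMulAction_polytabloid (k : Type*) [Field k] (σ : Equiv.Perm X) (t : Tableau X lam) :
    Representation.ofMulAction k (Equiv.Perm X) (Tabloid X lam) σ (polytabloid k t)
      = polytabloid k (t.trans σ) := by
  simp only [polytabloid, map_sum, Representation.ofMulAction_single]
  refine Finset.sum_bij' (fun π _ => σ * π * σ⁻¹) (fun π _ => σ⁻¹ * π * σ) ?_ ?_ ?_ ?_ ?_
  · intro π hπ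
    refine Finset.mem_filter.2 ⟨Finset.mem_univ _, fun x => ?_⟩
    replace hπ := (Finset.mem_filter.1 hπ).2
    simp only [Tableau.colOf, Equiv.symm_trans_apply] at hπ ⊢
    simpa using hπ (σ.symm x)
  · intro π hπ
    refine Finset.mem_filter.2 ⟨Finset.mem_univ _, fun x => ?_⟩
    replace hπ := (Finset.mem_filter.1 hπ).2
    simp only [Tableau.colOf, Equiv.symm_trans_apply] at hπ ⊢
    simpa using hπ (σ x)
  · intro π _
    group
  · intro π _
    group
  · intro π _
    rw [← smul_tabloid, ← mul_smul, ← mul_smul]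
    simp [Equiv.Perm.sign_mul, mul_comm (Equiv.Perm.sign σ), mul_assoc]

variable (k : Type*) [Field k] (X lam)

/-- The Specht module `S^lam`, for `lam` a partition of the cardinality of `X`: the submodule of
the permutation module on tabloids spanned by the polytabloids. -/
def specht : Subrepresentation
    (Representation.ofMulAction k (Equiv.Perm X) (Tabloid X lam)) where
  toSubmodule := Submodule.span k (Set.range (polytabloid (X := X) (lam := lam) k))
  apply_mem_toSubmodule σ v hv := by
    induction hv using Submodule.span_induction with
    | mem v hv =>
      obtain ⟨t, rfl⟩ := hv
      rw [ofMulAction_polytabloid]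
      exact Submodule.subset_span ⟨_, rfl⟩
    | zero => rw [map_zero]; exact Submodule.zero_mem _
    | add a b _ _ ha hb => rw [map_add]; exact Submodule.add_mem _ ha hb
    | smul c a _ ha => rw [map_smul]; exact Submodule.smul_mem _ c ha

/-- The underlying vector space of the Specht module `S^lam`. -/
abbrev SpechtModule : Type _ := (specht X lam k).toSubmodule

/-- The Specht module `S^lam` as a representation of the symmetric group on `X`. -/
abbrev spechtRep : Representation k (Equiv.Perm X) (SpechtModule X lam k) :=
  (specht X lam k).toRepresentation

end Specht

/-! ### The partitions of `m` in lexicographic order -/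

/-- The partitions of `m`, as Young diagrams. -/
structure PartitionOf (m : ℕ) where
  diagram : YoungDiagram
  card_eq : diagram.card = m

lemma PartitionOf.diagram_injective {m : ℕ} :
    Function.Injective (PartitionOf.diagram (m := m)) := by
  rintro ⟨a, ha⟩ ⟨b, hb⟩ h
  cases h
  rfl

lemma rowLens_injective : Function.Injective YoungDiagram.rowLens := by
  intro a b h
  apply YoungDiagram.equivListRowLens.injective
  exact Subtype.ext h

instance (m : ℕ) : Finite (PartitionOf m) := by
  have key : ∀ μ : PartitionOf m, μ.diagram.cells ∈
      (Finset.range m ×ˢ Finset.range m).powerset := by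
    intro μ
    rw [Finset.mem_powerset]
    rintro ⟨i, j⟩ hc
    have hrow : μ.diagram.rowLen i ≤ m := by
      rw [YoungDiagram.rowLen_eq_card]
      exact (Finset.card_le_card (Finset.filter_subset _ _)).trans μ.card_eq.le
    have hcol : μ.diagram.colLen j ≤ m := by
      rw [YoungDiagram.colLen_eq_card]
      exact (Finset.card_le_card (Finset.filter_subset _ _)).trans μ.card_eq.le
    have h1 := YoungDiagram.mem_iff_lt_rowLen.1 ((YoungDiagram.mem_cells _).1 hc)
    have h2 := YoungDiagram.mem_iff_lt_colLen.1 ((YoungDiagram.mem_cells _).1 hc)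
    simp only [Finset.mem_product, Finset.mem_range]
    omega
  refine Finite.of_injective (β := (Finset.range m ×ˢ Finset.range m).powerset)
    (fun μ => ⟨μ.diagram.cells, key μ⟩) ?_
  intro a b h
  exact PartitionOf.diagram_injective (YoungDiagram.ext (congrArg Subtype.val h))

instance (m : ℕ) : Fintype (PartitionOf m) := Fintype.ofFinite _

/-- The lexicographic order on partitions of `m`, comparing the first rows, then the second rows,
and so on. -/
instance (m : ℕ) : LinearOrder (PartitionOf m) :=
  LinearOrder.lift' (fun μ => μ.diagram.rowLens)
    (rowLens_injective.comp PartitionOf.diagram_injective)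

/-- The number `r` of partitions of `m`. -/
abbrev numPartitions (m : ℕ) : ℕ := Fintype.card (PartitionOf m)

/-- The partitions of `m` listed in decreasing lexicographic order,
`(m) = μ 0 > μ 1 > ⋯ > μ (r - 1) = (1^m)`. -/
def mu (m : ℕ) (i : Fin (numPartitions m)) : YoungDiagram :=
  PartitionOf.diagram
    (OrderDual.ofDual (Fintype.orderIsoFinOfCardEq (PartitionOf m)ᵒᵈ rfl i))

/-! ### Multipartitions and their Young subgroups -/

/-- An `s`-multipartition of `n`: an `s`-tuple of partitions, given by their Young diagrams, whose
sizes add up to `n`. -/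
@[ext]
structure Multipartition (s n : ℕ) where
  comp : Fin s → YoungDiagram
  sum_card : ∑ i, (comp i).card = n

namespace Multipartition

variable {s n : ℕ}

/-- `del` is obtained from `lam` by removing one box from the `i`-th component and leaving all the
other components unchanged. -/
def IsRemoveBox {n' : ℕ} (del : Multipartition s n') (lam : Multipartition s n) (i : Fin s) :
    Prop :=
  (∃ c ∈ (lam.comp i).cells, (del.comp i).cells = (lam.comp i).cells.erase c) ∧
    ∀ j, j ≠ i → del.comp j = lam.comp j

/-- The points `0, …, n - 1` are divided into `s` consecutive blocks of lengths
`|η^1|, …, |η^s|`; this is the index of the block containing `x`. -/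
def blockIdx (η : Multipartition s n) (x : Fin n) : Fin s :=
  (finSigmaFinEquiv.symm (Fin.cast η.sum_card.symm x)).1

/-- The `i`-th block, consisting of `|η^i|` consecutive points. -/
abbrev Block (η : Multipartition s n) (i : Fin s) : Type := {x : Fin n // η.blockIdx x = i}

/-- The Young subgroup of the composition `(|η^1|, …, |η^s|)` of `n`. -/
def youngSubgroup (η : Multipartition s n) : Subgroup (Equiv.Perm (Fin n)) where
  carrier := {σ | ∀ x, η.blockIdx (σ x) = η.blockIdx x}
  one_mem' _ := rfl
  mul_mem' {σ τ} hσ hτ x := (hσ (τ x)).trans (hτ x)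
  inv_mem' {σ} hσ x := by simpa using (hσ (σ⁻¹ x)).symm

/-- The projection of the Young subgroup onto the symmetric group of its `i`-th block. -/
def youngProj (η : Multipartition s n) (i : Fin s) :
    η.youngSubgroup →* Equiv.Perm (η.Block i) where
  toFun σ := σ.1.subtypePerm fun x => by rw [σ.2 x]
  map_one' := rfl
  map_mul' _ _ := rfl

end Multipartition

/-! ### Wreath products -/

/-- The wreath product `G ≀ Sym(X)`: pairs of a family in `X → G` and a permutation of `X`, with
`(α, σ) (β, π) = (x ↦ α x * β (σ⁻¹ x), σ π)`. -/
abbrev Wreath (G X : Type*) [Group G] : Type _ :=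
  (X → G) ⋊[mulAutArrow (G := Equiv.Perm X) (A := X) (M := G)] Equiv.Perm X

section Wreath

variable {G : Type*} [Group G]

lemma Wreath.mul_left_apply {X : Type*} (a b : Wreath G X) (x : X) :
    (a * b).left x = a.left x * b.left (a.right⁻¹ x) := rfl

/-- The embedding `G ≀ S_n → G ≀ S_(n+1)`, `(α_1, …, α_n; σ) ↦ (α_1, …, α_n, 1; σ)`, where `σ` is
extended by fixing the last point. -/
def wreathEmb (G : Type*) [Group G] (n : ℕ) : Wreath G (Fin n) →* Wreath G (Fin (n + 1)) where
  toFun a := ⟨Fin.snoc (α := fun _ => G) a.left 1,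
    Equiv.Perm.viaEmbeddingHom Fin.castSuccEmb a.right⟩
  map_one' := by
    refine SemidirectProduct.ext (funext fun x => ?_) (map_one _)
    refine Fin.lastCases ?_ (fun i => ?_) x <;> simp
  map_mul' a b := by
    refine SemidirectProduct.ext (funext fun x => ?_) (map_mul _ _ _)
    rw [Wreath.mul_left_apply, ← map_inv]
    refine Fin.lastCases ?_ (fun i => ?_) x
    · have h : (Equiv.Perm.viaEmbeddingHom (Fin.castSuccEmb (n := n)) a.right⁻¹)
          (Fin.last n) = Fin.last n :=
        Equiv.Perm.viaEmbedding_apply_of_notMem _ _ _ (by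
          rintro ⟨y, hy⟩
          exact (Fin.castSucc_lt_last y).ne hy)
      rw [h]
      simp
    · have h : (Equiv.Perm.viaEmbeddingHom (Fin.castSuccEmb (n := n)) a.right⁻¹)
          i.castSucc = (a.right⁻¹ i).castSucc :=
        Equiv.Perm.viaEmbedding_apply a.right⁻¹ Fin.castSuccEmb i
      rw [h]
      simp only [Fin.snoc_castSucc]
      rfl

variable (G) {s n : ℕ} (η : Multipartition s n)

/-- The subgroup `G ≀ S_γ` of `G ≀ S_n`, where `γ = (|η^1|, …, |η^s|)`. -/
def wreathYoung : Subgroup (Wreath G (Fin n)) :=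
  η.youngSubgroup.comap SemidirectProduct.rightHom

/-- The projection `G ≀ S_γ → S_γ`. -/
def wreathYoungRight : wreathYoung G η →* η.youngSubgroup where
  toFun a := ⟨a.1.right, a.2⟩
  map_one' := rfl
  map_mul' _ _ := rfl

/-- The projection of `G ≀ S_γ` onto the factor `G ≀ Sym(i-th block)`. -/
def wreathYoungProj (i : Fin s) : wreathYoung G η →* Wreath G (η.Block i) where
  toFun a := ⟨fun x => a.1.left x, η.youngProj i (wreathYoungRight G η a)⟩
  map_one' := rfl
  map_mul' _ _ := rfl

end Wreath

/-! ### Modules for wreath products -/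

section Modules

variable {k : Type u} [Field k]

/-- The tensor product `⨂ i, V i` of representations of `H`, with the diagonal action. -/
def piTensorRep {H : Type*} [Group H] {ι : Type*} {V : ι → Type*} [∀ i, AddCommGroup (V i)]
    [∀ i, Module k (V i)] (ρ : ∀ i, Representation k H (V i)) :
    Representation k H (⨂[k] i, V i) where
  toFun h := PiTensorProduct.map fun i => ρ i h
  map_one' := by
    simp only [map_one]
    exact PiTensorProduct.map_one
  map_mul' g h := by
    simp only [map_mul]
    exact PiTensorProduct.map_mul _ _

/-- The representation of `G ≀ Sym(X)` on the tensor power of a representation of `G`, in which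
`(α, σ)` maps `⨂ x, v x` to `⨂ x, α x • v (σ⁻¹ x)`. -/
def tensorPowerRep {G : Type*} [Group G] (X : Type*) {V : Type*} [AddCommGroup V] [Module k V]
    (ρ : Representation k G V) : Representation k (Wreath G X) (⨂[k] _ : X, V) where
  toFun a := (PiTensorProduct.map fun x => ρ (a.left x)) ∘ₗ
    (PiTensorProduct.reindex k (fun _ => V) a.right).toLinearMap
  map_one' := by
    ext v
    simp [PiTensorProduct.reindex_tprod]
    rfl
  map_mul' a b := by
    ext v
    simp [PiTensorProduct.reindex_tprod, PiTensorProduct.map_tprod]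
    rfl

variable {G : Type*} [Group G] {s n : ℕ} (η : Multipartition s n)
  {V : Fin s → Type*} [∀ i, AddCommGroup (V i)] [∀ i, Module k (V i)]

variable (k) (V) in
/-- The underlying vector space `(Y_1^{⊗γ_1} ⊗ ⋯ ⊗ Y_s^{⊗γ_s}) ⊗ (S^{η^1} ⊗ ⋯ ⊗ S^{η^s})`,
`γ = (|η^1|, …, |η^s|)`, of the module below. -/
def InnerSpace : Type _ :=
  (⨂[k] i, ⨂[k] _ : η.Block i, V i) ⊗[k] (⨂[k] i, SpechtModule (η.Block i) (η.comp i) k)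

instance : AddCommGroup (InnerSpace k η V) :=
  inferInstanceAs (AddCommGroup
    ((⨂[k] i, ⨂[k] _ : η.Block i, V i) ⊗[k] (⨂[k] i, SpechtModule (η.Block i) (η.comp i) k)))

instance : Module k (InnerSpace k η V) :=
  inferInstanceAs (Module k
    ((⨂[k] i, ⨂[k] _ : η.Block i, V i) ⊗[k] (⨂[k] i, SpechtModule (η.Block i) (η.comp i) k)))

/-- The `k(G ≀ S_γ)`-module `(Y_1, …, Y_s)^{⊠γ} ⊘ (S^{η^1} ⊠ ⋯ ⊠ S^{η^s})`,
`γ = (|η^1|, …, |η^s|)`: the whole of `G ≀ S_γ` acts on the first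
factor and `S_γ = S_{γ_1} × ⋯ × S_{γ_s}` acts on the second. -/
def wreathSpechtInner (Y : ∀ i, Representation k G (V i)) :
    Representation k (wreathYoung G η) (InnerSpace k η V) :=
  Representation.tprod
    (piTensorRep fun i => (tensorPowerRep (η.Block i) (Y i)).comp (wreathYoungProj G η i))
    ((piTensorRep fun i => (spechtRep (η.Block i) (η.comp i) k).comp (η.youngProj i)).comp
      (wreathYoungRight G η))

/-- The underlying vector space of `S^η(Y_1, …, Y_s)`. -/
abbrev WreathSpechtSpace (Y : ∀ i, Representation k G (V i)) : Type _ :=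
  Representation.IndV (wreathYoung G η).subtype (wreathSpechtInner η Y)

/-- The `k(G ≀ S_n)`-module `S^η(Y_1, …, Y_s)`, induced from `G ≀ S_γ`. -/
def wreathSpechtOf (Y : ∀ i, Representation k G (V i)) :
    Representation k (Wreath G (Fin n)) (WreathSpechtSpace η Y) :=
  Representation.ind (wreathYoung G η).subtype (wreathSpechtInner η Y)

variable (k) (m : ℕ)

/-- The wreath product Specht module `S^ν = S^ν(S^{μ^1}, …, S^{μ^r})` for `S_m ≀ S_n`, where
`μ^1 > ⋯ > μ^r` are the partitions of `m` and `ν` is an `r`-multipartition of `n`. -/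
def wreathSpecht (ν : Multipartition (numPartitions m) n) :
    Representation k (Wreath (Equiv.Perm (Fin m)) (Fin n))
      (WreathSpechtSpace ν fun i => spechtRep (Fin m) (mu m i) k) :=
  wreathSpechtOf ν fun i => spechtRep (Fin m) (mu m i) k

end Modules

end WreathSpecht

end

/-! The proof replaces spans of polytabloids by spaces of highest weight vectors, on which
restriction can be read off from the row of the last point. A function `(X → ℕ) → k` is read as the
coefficients of a tensor whose factors have a basis `e_0, e_1, …` indexed by rows. Given a colouring
of `X` and a diagram for each colour, consider the tensors whose weight is given by the row lengths
and which are fixed by the unipotents sending `e_{j+1}` to `e_{j+1} + e_j` in one colour. Group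
elements stand in for all divided powers of the raising operators at once, so the characteristic
plays no role.

`highestWeight_eq_polySpan`, a coloured form of James's kernel intersection theorem, says that these
vectors are exactly the combinations of coloured polytabloids. It goes by induction on the number of
points. In a nonzero highest weight vector take the largest row `j` that the last point can occupy.
The corresponding slice is again a highest weight vector (`slice_mem_highestWeight`), so its weight
is a partition (`highestWeight_eq_zero`), and row `j` ends in a removable box. By induction this
slice is a combination of smaller polytabloids. Putting the last point into the removed box lifts
them to larger polytabloids with the same leading slice, and subtracting lowers `j`.

For the wreath product, fix bases of the modules `Y_i` and let the colour of a basis vector of `⨁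
Y_i` be its index `i`. The induced module embeds in the row functions with values in the tensor
power of `⨁ Y_i`. By `range_wreathSpechtEmb` its image consists of the vectors all of whose
coefficients are highest weight vectors for the colouring of the basis tensor concerned.

The smaller wreath product acts trivially on the last factor and fixes the last point. Extracting
the part with last factor a given basis vector and last point in a given row is therefore
equivariant. Only removable boxes matter, and at each the leading parts fill the whole smaller
Specht module. Taking these parts in increasing order of the row gives a filtration whose layers are
indexed by a removable box of some `λ^i` and a basis vector of `Y_i`; hence the multiplicity `dim
Y_i`. -/

noncomputable section

open scoped TensorProduct

namespace WreathSpecht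

/-! ### Row functions and highest weight vectors -/

section RowFunctions

open Finset

variable {X ι : Type*} [Fintype X] [DecidableEq ι] {k : Type*} [Field k]

/-- The number of points of each colour lying in each row. -/
def content (c : X → ι) (r : X → ℕ) (i : ι) (j : ℕ) : ℕ :=
  (univ.filter fun x => c x = i ∧ r x = j).card

/-- The points of each colour `i` are in bijection with the boxes of `D i`. -/
def IsFilling (c : X → ι) (D : ι → YoungDiagram) (t : X → ℕ × ℕ) : Prop :=
  ∀ i, Set.BijOn t {x | c x = i} (D i).cells

/-- The row lengths of a family of diagrams. -/
def rowLengths (D : ι → YoungDiagram) (i : ι) (j : ℕ) : ℕ := (D i).rowLen j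

lemma IsFilling.content_eq {c : X → ι} {D : ι → YoungDiagram} {t : X → ℕ × ℕ}
    (h : IsFilling c D t) : content c (fun x => (t x).1) = rowLengths D := by
  ext i j
  rw [content, rowLengths, YoungDiagram.rowLen_eq_card]
  refine card_bij (fun x _ => t x) ?_ ?_ ?_
  · intro x hx
    rw [mem_filter] at hx
    exact YoungDiagram.mem_row_iff.2 ⟨(h i).mapsTo hx.2.1, hx.2.2⟩
  · intro x hx y hy hxy
    exact (h i).injOn (mem_filter.1 hx).2.1 (mem_filter.1 hy).2.1 hxy
  · intro b hb
    obtain ⟨h1, h2⟩ := YoungDiagram.mem_row_iff.1 hb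
    obtain ⟨x, hx, rfl⟩ := (h i).surjOn h1
    exact ⟨x, mem_filter.2 ⟨mem_univ _, hx, h2⟩, rfl⟩

lemma content_comp_perm (c : X → ι) (r : X → ℕ) (π : Equiv.Perm X) :
    content (fun x => c (π x)) (fun x => r (π x)) = content c r := by
  ext i j
  exact card_bij' (fun x _ => π x) (fun x _ => π⁻¹ x) (by simp) (by simp) (by simp) (by simp)

variable [DecidableEq X]

/-- The function `r` with the values on `S` replaced by `j`. -/
def assign (S : Finset X) (j : ℕ) (r : X → ℕ) : X → ℕ := fun x => if x ∈ S then j else r x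

/-- The action of the tensor power of the elementary unipotent matrix moving row `j + 1` of
colour `i` to row `j`. -/
def unipotent (c : X → ι) (i : ι) (j : ℕ) (F : (X → ℕ) → k) (r : X → ℕ) : k :=
  ∑ S ∈ (univ.filter fun x => c x = i ∧ r x = j).powerset, F (assign S (j + 1) r)

/-- The vectors of weight `a` fixed by the upper unitriangular matrices of each colour. -/
def highestWeight (k : Type*) [Field k] (c : X → ι) (a : ι → ℕ → ℕ) :
    Submodule k ((X → ℕ) → k) where
  carrier := {F | (∀ r, F r ≠ 0 → content c r = a) ∧ ∀ i j r, unipotent c i j F r = F r}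
  zero_mem' := ⟨fun r h => absurd rfl h, fun i j r => by simp [unipotent]⟩
  add_mem' {F H} hF hH := by
    refine ⟨fun r h => ?_, fun i j r => ?_⟩
    · by_cases h0 : F r = 0
      · exact hH.1 r fun h1 => h (by simp [h0, h1])
      · exact hF.1 r h0
    · rw [Pi.add_apply, ← hF.2 i j r, ← hH.2 i j r]
      simp [unipotent, sum_add_distrib]
  smul_mem' a F hF := by
    refine ⟨fun r h => hF.1 r fun h0 => h (by simp [h0]), fun i j r => ?_⟩
    rw [Pi.smul_apply, ← hF.2 i j r]
    simp [unipotent, mul_sum]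

/-- The permutations preserving the colours and the columns of a filling. -/
def columnPerms (c : X → ι) (t : X → ℕ × ℕ) : Finset (Equiv.Perm X) :=
  univ.filter fun π => ∀ x, c (π x) = c x ∧ (t (π x)).2 = (t x).2

lemma mem_columnPerms {c : X → ι} {t : X → ℕ × ℕ} {π : Equiv.Perm X} :
    π ∈ columnPerms c t ↔ ∀ x, c (π x) = c x ∧ (t (π x)).2 = (t x).2 := by
  simp [columnPerms]

/-- The coefficients of the polytabloid of a coloured filling, as a function of the rows. -/
def polyFun (k : Type*) [Field k] (c : X → ι) (t : X → ℕ × ℕ) (r : X → ℕ) : k :=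
  ∑ π ∈ columnPerms c t,
    if ∀ x, r (π x) = (t x).1 then (((Equiv.Perm.sign π : ℤˣ) : ℤ) : k) else 0

lemma polyFun_content {c : X → ι} {D : ι → YoungDiagram} {t : X → ℕ × ℕ}
    (h : IsFilling c D t) {r : X → ℕ} (hr : polyFun k c t r ≠ 0) :
    content c r = rowLengths D := by
  obtain ⟨π, hπ, h0⟩ := exists_ne_zero_of_sum_ne_zero hr
  have h1 : ∀ x, r (π x) = (t x).1 := by
    by_contra h1
    simp [h1] at h0
  rw [← h.content_eq, ← content_comp_perm c r π]
  congr 1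
  · ext x
    exact (mem_columnPerms.1 hπ x).1
  · ext x
    exact h1 x

/-- The polytabloid with the rows of a filling replaced by a function taking equal values on two
points of the same column vanishes. -/
lemma sum_columnPerms_eq_zero {c : X → ι} {t : X → ℕ × ℕ} (r q : X → ℕ) {y z : X} (hyz : y ≠ z)
    (hc : c y = c z) (ht : (t y).2 = (t z).2) (hq : q y = q z) :
    ∑ π ∈ columnPerms c t,
      (if ∀ x, r (π x) = q x then (((Equiv.Perm.sign π : ℤˣ) : ℤ) : k) else 0) = 0 := by
  have hswap : ∀ x, c (Equiv.swap y z x) = c x ∧ (t (Equiv.swap y z x)).2 = (t x).2 ∧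
      q (Equiv.swap y z x) = q x := by
    intro x
    by_cases h1 : x = y
    · subst h1; simp [hc, ht, hq]
    by_cases h2 : x = z
    · subst h2; simp [hc, ht, hq]
    simp [Equiv.swap_apply_of_ne_of_ne h1 h2]
  refine sum_involution (fun π _ => π * Equiv.swap y z) ?_ ?_ ?_ ?_
  · intro π _
    have : (∀ x, r ((π * Equiv.swap y z) x) = q x) ↔ ∀ x, r (π x) = q x := by
      constructor
      · intro h x
        have := h (Equiv.swap y z x)
        simpa [(hswap x).2.2] using this
      · intro h x
        rw [Equiv.Perm.mul_apply, h, (hswap x).2.2]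
    simp only [this]
    split_ifs <;> simp [Equiv.Perm.sign_mul, Equiv.Perm.sign_swap hyz]
  · intro π _ _ h
    have := congrArg (fun σ => σ y) (mul_eq_left.1 h)
    simp at this
    exact hyz this.symm
  · intro π hπ
    refine mem_columnPerms.2 fun x => ?_
    have h1 := mem_columnPerms.1 hπ (Equiv.swap y z x)
    rw [Equiv.Perm.mul_apply, h1.1, h1.2]
    exact ⟨(hswap x).1, (hswap x).2.1⟩
  · intro π _
    simp [mul_assoc]

/-- The substitution `Q = π⁻¹ S` moves the unipotent from the argument `r` to the filling: altering
`r` on `S` to match `t` amounts to altering the rows of `t` on `Q` in the opposite direction. -/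
lemma sum_powerset_assign (c : X → ι) (t : X → ℕ × ℕ) (i : ι) (j : ℕ) (r : X → ℕ)
    {π : Equiv.Perm X} (hπ : π ∈ columnPerms c t) (s : k) :
    ∑ S ∈ (univ.filter fun x => c x = i ∧ r x = j).powerset,
        (if ∀ x, assign S (j + 1) r (π x) = (t x).1 then s else 0) =
      ∑ Q ∈ (univ.filter fun x => c x = i ∧ (t x).1 = j + 1).powerset,
        (if ∀ x, r (π x) = assign Q j (fun x => (t x).1) x then s else 0) := by
  have hc := fun x => (mem_columnPerms.1 hπ x).1
  rw [← sum_filter, ← sum_filter]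
  refine sum_bij' (fun S _ => S.map π.symm.toEmbedding) (fun Q _ => Q.map π.toEmbedding)
    ?_ ?_ ?_ ?_ ?_
  · intro S hS
    rw [mem_filter, mem_powerset] at hS ⊢
    have hmem : ∀ x, x ∈ S.map π.symm.toEmbedding ↔ π x ∈ S := fun x => by
      rw [mem_map_equiv]; simp
    refine ⟨fun x hx => ?_, fun x => ?_⟩
    · rw [hmem] at hx
      have h1 := hS.2 x
      have h2 := (mem_filter.1 (hS.1 hx)).2
      simp only [assign, hx, if_true] at h1
      exact mem_filter.2 ⟨mem_univ _, (hc x).symm.trans h2.1, h1.symm⟩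
    · have h1 := hS.2 x
      simp only [assign, hmem] at h1 ⊢
      split_ifs with hx
      · exact (mem_filter.1 (hS.1 hx)).2.2
      · simpa [hx] using h1
  · intro Q hQ
    rw [mem_filter, mem_powerset] at hQ ⊢
    have hmem : ∀ x, π x ∈ Q.map π.toEmbedding ↔ x ∈ Q := fun x => by
      rw [mem_map_equiv]; simp
    refine ⟨fun x hx => ?_, fun x => ?_⟩
    · obtain ⟨y, hy, rfl⟩ := mem_map.1 hx
      have h1 := hQ.2 y
      simp only [assign, hy, if_true] at h1
      exact mem_filter.2 ⟨mem_univ _, (hc y).trans (mem_filter.1 (hQ.1 hy)).2.1, h1⟩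
    · have h1 := hQ.2 x
      simp only [assign, hmem] at h1 ⊢
      split_ifs with hx
      · exact (mem_filter.1 (hQ.1 hx)).2.2.symm
      · simpa [hx] using h1
  · intro S _
    ext x; simp
  · intro S _
    ext x; simp
  · simp

/-- Polytabloids are highest weight vectors. -/
theorem polyFun_mem_highestWeight {c : X → ι} {D : ι → YoungDiagram} {t : X → ℕ × ℕ}
    (h : IsFilling c D t) : polyFun k c t ∈ highestWeight k c (rowLengths D) := by
  refine ⟨fun r hr => polyFun_content h hr, fun i j r => ?_⟩
  simp only [unipotent, polyFun]
  rw [sum_comm, sum_congr rfl fun π hπ => sum_powerset_assign c t i j r hπ _, sum_comm,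
    sum_eq_single_of_mem ∅ (empty_mem_powerset _)]
  · simp [assign]
  · intro Q hQ hne
    obtain ⟨z, hz⟩ := nonempty_iff_ne_empty.2 hne
    have hzP := (mem_filter.1 (mem_powerset.1 hQ hz)).2
    -- The box directly above `z` lies in the diagram, and its occupant `y` is not in `Q`. Moving
    -- `Q` to row `j` puts `y` and `z` in the same row and column, so the signed sum cancels. Only
    -- `Q = ∅` survives, and it gives the polytabloid itself.
    have hbox : ((j, (t z).2) : ℕ × ℕ) ∈ (D i).cells := by
      have h1 : t z ∈ (D i).cells := (h i).mapsTo hzP.1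
      exact (D i).isLowerSet (show ((j, (t z).2) : ℕ × ℕ) ≤ t z from
        ⟨by simp [hzP.2], le_rfl⟩) h1
    obtain ⟨y, hy, hty⟩ := (h i).surjOn hbox
    have hyz : y ≠ z := by
      rintro rfl
      rw [hty] at hzP
      simp at hzP
    refine sum_columnPerms_eq_zero r _ hyz (hy.trans hzP.1.symm) (by rw [hty]) ?_
    have hyQ : y ∉ Q := fun hyQ => by
      have := (mem_filter.1 (mem_powerset.1 hQ hyQ)).2.2
      rw [hty] at this
      simp at this
    simp [assign, hz, hyQ, hty]

/-- There are no nonzero highest weight vectors whose weight is not a partition. -/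
theorem highestWeight_eq_zero {c : X → ι} {a : ι → ℕ → ℕ} {i : ι} {j : ℕ}
    (hij : a i j < a i (j + 1)) {F : (X → ℕ) → k} (hF : F ∈ highestWeight k c a) : F = 0 := by
  by_contra hne
  obtain ⟨g, hg⟩ := Function.ne_iff.1 hne
  set A := univ.filter fun x => c x = i ∧ g x = j with hA
  set B := univ.filter fun x => c x = i ∧ g x = j + 1 with hB
  have hAcard : A.card = a i j := by rw [← hF.1 g hg]; rfl
  have hBcard : B.card = a i (j + 1) := by rw [← hF.1 g hg]; rfl
  set C := A ∪ B with hC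
  -- The rows are kept as in `g` outside `C`; within `C` the points of `T` lie in row `j + 1` and
  -- the others in row `j`. The weight makes `h` vanish off subsets of size `a i (j + 1)`, and
  -- invariance makes the sum of `h` over the supersets of `P` equal to `h P`.
  set h : Finset X → k := fun T => F (assign T (j + 1) (assign C j g)) with hh
  have hCi : ∀ x ∈ C, c x = i := by
    intro x hx
    simp only [hC, hA, hB, mem_union, mem_filter] at hx
    tauto
  have hCj : ∀ x ∉ C, c x = i → g x ≠ j ∧ g x ≠ j + 1 := by
    intro x hx
    simp only [hC, hA, hB, mem_union, mem_filter, mem_univ, true_and] at hx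
    tauto
  have h0 : ∀ T ⊆ C, T.card ≠ a i (j + 1) → h T = 0 := by
    intro T hT hcard
    by_contra h1
    apply hcard
    rw [← hF.1 _ h1, content]
    congr 1
    ext x
    rw [mem_filter, and_iff_right (mem_univ x)]
    simp only [assign]
    by_cases hxT : x ∈ T
    · simp [hxT, hCi x (hT hxT)]
    · by_cases hxC : x ∈ C
      · simp [hxT, hxC]
      · simp only [hxT, hxC, if_false, false_iff]
        exact fun h2 => (hCj x hxC h2.1).2 h2.2
  have hsum : ∀ P ⊆ C, ∑ S ∈ (C \ P).powerset, h (P ∪ S) = h P := by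
    intro P hP
    rw [hh]
    dsimp only
    rw [← hF.2 i j (assign P (j + 1) (assign C j g)), unipotent]
    have hset : (univ.filter fun x => c x = i ∧ assign P (j + 1) (assign C j g) x = j)
        = C \ P := by
      ext x
      rw [mem_filter, and_iff_right (mem_univ x), mem_sdiff]
      simp only [assign]
      by_cases hxP : x ∈ P
      · simp [hxP]
      · by_cases hxC : x ∈ C
        · simp [hxP, hxC, hCi x hxC]
        · simp only [hxP, hxC, if_false, false_and, iff_false]
          exact fun h2 => (hCj x hxC h2.1).1 h2.2
    rw [hset]
    refine sum_congr rfl fun S _ => congrArg F (funext fun x => ?_)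
    simp only [assign, mem_union]
    by_cases hxP : x ∈ P <;> by_cases hxS : x ∈ S <;> simp [hxP, hxS]
  -- The sum runs over the subsets of `C` that contain `P` and avoid `Q`. Adding `x` to `Q` is
  -- inclusion–exclusion: from the sets avoiding `Q`, remove those containing `x`, which are the sum
  -- for `insert x P` and `Q`.
  have key : ∀ Q ⊆ C, ∀ P ⊆ C, Disjoint P Q → P.card + Q.card < a i (j + 1) →
      ∑ S ∈ ((C \ P) \ Q).powerset, h (P ∪ S) = 0 := by
    intro Q
    induction Q using Finset.induction_on with
    | empty =>
      intro _ P hP _ hcard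
      rw [sdiff_empty, hsum P hP]
      exact h0 P hP (by simp at hcard; omega)
    | insert x Q hxQ ih =>
      intro hQ P hP hdisj hcard
      rw [card_insert_of_notMem hxQ] at hcard
      rw [disjoint_insert_right] at hdisj
      have hxC : x ∈ C := hQ (mem_insert_self _ _)
      have h1 := ih ((subset_insert _ _).trans hQ) P hP hdisj.2 (by omega)
      have h2 := ih ((subset_insert _ _).trans hQ) (insert x P) (insert_subset hxC hP)
        (disjoint_insert_left.2 ⟨hxQ, hdisj.2⟩) (by rw [card_insert_of_notMem hdisj.1]; omega)
      have hset : (C \ P) \ Q = insert x ((C \ P) \ insert x Q) := by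
        ext y
        simp only [mem_sdiff, mem_insert]
        by_cases hy : y = x
        · subst hy; simp [hxC, hdisj.1, hxQ]
        · simp [hy]
      have hset2 : (C \ insert x P) \ Q = (C \ P) \ insert x Q := by
        ext y
        simp only [mem_sdiff, mem_insert]
        tauto
      rw [hset, sum_powerset_insert (by simp)] at h1
      rw [hset2] at h2
      rw [sum_congr rfl (fun S _ => by rw [union_insert, ← insert_union] :
        ∀ S ∈ ((C \ P) \ insert x Q).powerset, h (P ∪ insert x S) = h (insert x P ∪ S)), h2,
        add_zero] at h1
      exact h1
  -- The subsets avoiding `A` are those of `B`, and the strict inequality of weights is what allows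
  -- `Q = A`. Among subsets of `B` only `B` itself has the right size, and `h B = F g`.
  have hfin := key A subset_union_left ∅ (empty_subset _) (disjoint_empty_left _)
    (by simp only [card_empty, zero_add]; omega)
  have hAB : Disjoint A B := by
    rw [disjoint_left]
    intro x h1 h2
    have := (mem_filter.1 h1).2.2
    have := (mem_filter.1 h2).2.2
    omega
  rw [sdiff_empty, hC, union_sdiff_cancel_left hAB,
    sum_eq_single_of_mem B (mem_powerset_self _)] at hfin
  · apply hg
    rw [empty_union] at hfin
    rw [Pi.zero_apply, ← hfin, hh]
    refine congrArg F (funext fun x => ?_)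
    simp only [assign, hC, hA, hB, mem_union, mem_filter, mem_univ, true_and]
    split_ifs <;> grind
  · intro S hS hne
    rw [empty_union]
    refine h0 S ((mem_powerset.1 hS).trans subset_union_right) fun hcard => hne ?_
    exact eq_of_subset_of_card_le (mem_powerset.1 hS) (by omega)

end RowFunctions

/-! ### Removing a box from the end of a row -/

section RemoveRow

open Finset

variable {ι : Type*}

/-- The diagrams `D'` are obtained from `D` by removing the last box of row `j` of `D i`. -/
def IsRemoveRow (D' D : ι → YoungDiagram) (i : ι) (j : ℕ) : Prop :=
  ∃ l, (j, l) ∈ (D i).cells ∧ (D' i).cells = (D i).cells.erase (j, l) ∧ ∀ i' ≠ i, D' i' = D i'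

/-- The removed box is at the foot of its column. -/
lemma IsRemoveRow.col_le {D' D : ι → YoungDiagram} {i : ι} {j : ℕ} (h : IsRemoveRow D' D i j) :
    ∃ l, (j, l) ∈ (D i).cells ∧ (D' i).cells = (D i).cells.erase (j, l) ∧
      (∀ j', (j', l) ∈ (D i).cells → j' ≤ j) ∧ ∀ i' ≠ i, D' i' = D i' := by
  obtain ⟨b, hb, hD, hne⟩ := h
  refine ⟨b, hb, hD, fun j' hj' => ?_, hne⟩
  by_contra hlt
  have h1 : ((j', b) : ℕ × ℕ) ∈ (D' i).cells := by
    rw [hD, mem_erase]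
    exact ⟨fun h => hlt (Prod.mk.inj h).1.le, hj'⟩
  have h2 : ((j, b) : ℕ × ℕ) ∈ (D' i).cells :=
    (D' i).isLowerSet (show ((j, b) : ℕ × ℕ) ≤ (j', b) from ⟨(not_le.1 hlt).le, le_rfl⟩) h1
  rw [hD] at h2
  simp at h2

end RemoveRow

/-! ### Slices by the row of the last point, and the spanning theorem for polytabloids -/

section Slices

open Finset

variable {ι : Type*} [DecidableEq ι] {k : Type*} [Field k] {n : ℕ}

/-- The part of a function of rows in which the last point lies in row `j`. -/
def slice (j : ℕ) : ((Fin (n + 1) → ℕ) → k) →ₗ[k] ((Fin n → ℕ) → k) where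
  toFun F r := F (Fin.snoc (α := fun _ => ℕ) r j)
  map_add' _ _ := rfl
  map_smul' _ _ := rfl

lemma slice_apply (j : ℕ) (F : (Fin (n + 1) → ℕ) → k) (r : Fin n → ℕ) :
    slice j F r = F (Fin.snoc (α := fun _ => ℕ) r j) := rfl

lemma eq_zero_of_slice_eq_zero {F : (Fin (n + 1) → ℕ) → k} (h : ∀ j, slice j F = 0) : F = 0 := by
  ext r
  rw [← Fin.snoc_init_self r]
  exact congrFun (h (r (Fin.last n))) (Fin.init r)

lemma content_snoc (c : Fin (n + 1) → ι) (r : Fin n → ℕ) (j : ℕ) (i : ι) (l : ℕ) :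
    content c (Fin.snoc (α := fun _ => ℕ) r j) i l =
      content (fun x => c x.castSucc) r i l + if i = c (Fin.last n) ∧ l = j then 1 else 0 := by
  simp only [content, card_filter, Fin.sum_univ_castSucc, Fin.snoc_castSucc, Fin.snoc_last]
  simp only [eq_comm]

/-- The leading slice of a highest weight vector is a highest weight vector. -/
theorem slice_mem_highestWeight {c : Fin (n + 1) → ι} {a a' : ι → ℕ → ℕ} {j : ℕ}
    (ha : ∀ i l, a i l = a' i l + if i = c (Fin.last n) ∧ l = j then 1 else 0)
    {F : (Fin (n + 1) → ℕ) → k} (hF : F ∈ highestWeight k c a) (hj : slice (j + 1) F = 0) :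
    slice j F ∈ highestWeight k (fun x => c x.castSucc) a' := by
  refine ⟨fun r hr => ?_, fun i l r => ?_⟩
  · ext i l
    have h1 := congrFun (congrFun (hF.1 _ hr) i) l
    rw [content_snoc, ha] at h1
    omega
  · rw [slice_apply, ← hF.2 i l, unipotent, unipotent]
    set r' : Fin (n + 1) → ℕ := Fin.snoc (α := fun _ => ℕ) r j with hr'
    have hassign : ∀ S : Finset (Fin n),
        assign (S.map Fin.castSuccEmb) (l + 1) r' =
          Fin.snoc (α := fun _ => ℕ) (assign S (l + 1) r) j := by
      intro S
      ext x
      refine Fin.lastCases ?_ (fun x => ?_) x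
      · simp [assign, hr', Fin.castSucc_ne_last]
      · simp [assign, hr']
    simp only [slice_apply, ← hassign]
    refine sum_bij_ne_zero (fun S _ _ => S.map Fin.castSuccEmb) ?_ ?_ ?_ ?_
    · intro S hS _
      rw [mem_powerset] at hS ⊢
      intro x hx
      obtain ⟨y, hy, rfl⟩ := mem_map.1 hx
      have := (mem_filter.1 (hS hy)).2
      exact mem_filter.2 ⟨mem_univ _, by simpa [hr'] using this⟩
    · intro S _ _ S' _ _ h
      exact map_injective _ h
    · intro S hS h0
      rw [mem_powerset] at hS
      -- A subset moving the last point occurs only for `l = j`, and its term then lies in slice `j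
      -- + 1`, which vanishes by hypothesis.
      have hlast : Fin.last n ∉ S := by
        intro hlast
        apply h0
        have h1 := (mem_filter.1 (hS hlast)).2
        have h2 : j = l := by simpa [hr'] using h1.2
        have h3 := congrFun hj (Fin.init (assign S (l + 1) r'))
        have h4 : assign S (l + 1) r' (Fin.last n) = j + 1 := by simp [assign, hlast, h2]
        rw [slice_apply, ← h4, Fin.snoc_init_self] at h3
        exact h3
      have hS' : (univ.filter fun x : Fin n => x.castSucc ∈ S).map Fin.castSuccEmb = S := by
        ext x
        refine Fin.lastCases ?_ (fun x => ?_) x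
        · simp [hlast, Fin.castSucc_ne_last]
        · simp
      refine ⟨univ.filter fun x => x.castSucc ∈ S, ?_, ?_, hS'⟩
      · rw [mem_powerset]
        intro x hx
        have := (mem_filter.1 (hS (mem_filter.1 hx).2)).2
        exact mem_filter.2 ⟨mem_univ _, by simpa [hr'] using this⟩
      · rwa [hS']
    · intro S _ _
      rfl

lemma IsRemoveRow.rowLengths_eq {D' D : ι → YoungDiagram} {i : ι} {j : ℕ}
    (h : IsRemoveRow D' D i j) (i' : ι) (l : ℕ) :
    rowLengths D i' l = rowLengths D' i' l + if i' = i ∧ l = j then 1 else 0 := by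
  obtain ⟨b, hb, hD, hne⟩ := h
  by_cases hi : i' = i
  · subst hi
    simp only [rowLengths, YoungDiagram.rowLen_eq_card, YoungDiagram.row, hD, true_and]
    split_ifs with hl
    · subst hl
      rw [filter_erase]
      exact (card_erase_add_one (mem_filter (p := fun x => x.1 = l) |>.2 ⟨hb, rfl⟩)).symm
    · rw [filter_erase, erase_eq_of_notMem, add_zero]
      intro hm
      exact hl (mem_filter.1 hm).2.symm
  · simp [rowLengths, hne i' hi, hi]

lemma eq_of_rowLengths_eq {D D' : YoungDiagram} (h : ∀ j, D.rowLen j = D'.rowLen j) : D = D' := by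
  ext ⟨a, b⟩
  rw [YoungDiagram.mem_cells, YoungDiagram.mem_cells, YoungDiagram.mem_iff_lt_rowLen,
    YoungDiagram.mem_iff_lt_rowLen, h]

/-- If lowering the length of row `j` of `D i` by one leaves a partition, then a box can be removed
from this row. -/
lemma exists_isRemoveRow {D : ι → YoungDiagram} {i : ι} {j : ℕ}
    {a : ι → ℕ → ℕ} (ha : ∀ l, a i (l + 1) ≤ a i l)
    (h : ∀ i' l, rowLengths D i' l = a i' l + if i' = i ∧ l = j then 1 else 0) :
    ∃ D', IsRemoveRow D' D i j := by
  have hanti : Antitone (a i) := antitone_nat_of_succ_le ha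
  have hj : (D i).rowLen j = a i j + 1 := by simpa [rowLengths] using h i j
  have hl : ∀ l, l ≠ j → (D i).rowLen l = a i l := fun l hl => by
    simpa [rowLengths, hl] using h i l
  -- Columns count from zero, so `(j, a i j)` is the last box of row `j`. It is a corner because
  -- every lower row has length at most `a i j`.
  have hlow : IsLowerSet (((D i).cells.erase (j, a i j) : Finset (ℕ × ℕ)) : Set (ℕ × ℕ)) := by
    rintro ⟨x, y⟩ ⟨x', y'⟩ ⟨hx, hy⟩ hm
    simp only [] at hx hy
    have hm' := mem_erase.1 (mem_coe.1 hm)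
    refine mem_coe.2 (mem_erase.2 ⟨?_, (D i).isLowerSet (show ((x', y') : ℕ × ℕ) ≤ (x, y) from
      ⟨hx, hy⟩) hm'.2⟩)
    rintro h1
    obtain ⟨h1, h1'⟩ := Prod.mk.inj h1
    subst h1 h1'
    have h2 := YoungDiagram.mem_iff_lt_rowLen.1 ((YoungDiagram.mem_cells _).1 hm'.2)
    by_cases hxj : x = x'
    · subst hxj
      apply hm'.1
      ext
      · rfl
      · simp only at *; omega
    · rw [hl x hxj] at h2
      have := hanti hx
      omega
  refine ⟨Function.update D i ⟨(D i).cells.erase (j, a i j), hlow⟩, a i j, ?_, ?_, ?_⟩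
  · rw [YoungDiagram.mem_cells, YoungDiagram.mem_iff_lt_rowLen]
    omega
  · simp
  · intro i' hi'
    simp [hi']

/-- A filling of the smaller diagrams extends to the larger ones by putting the last point into
the removed box. -/
lemma IsFilling.snoc {c : Fin (n + 1) → ι} {D' D : ι → YoungDiagram} {j l : ℕ}
    (hl : (j, l) ∈ (D (c (Fin.last n))).cells)
    (hD : (D' (c (Fin.last n))).cells = (D (c (Fin.last n))).cells.erase (j, l))
    (hne : ∀ i ≠ c (Fin.last n), D' i = D i)
    {t : Fin n → ℕ × ℕ} (ht : IsFilling (fun x => c x.castSucc) D' t) :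
    IsFilling c D (Fin.snoc (α := fun _ => ℕ × ℕ) t (j, l)) := by
  have hsub : ∀ i, (D' i).cells ⊆ (D i).cells := by
    intro i
    by_cases hi : i = c (Fin.last n)
    · rw [hi, hD]; exact erase_subset _ _
    · rw [hne i hi]
  intro i
  refine ⟨fun x => ?_, fun x => ?_, fun b hb => ?_⟩
  · refine Fin.lastCases ?_ (fun x => ?_) x
    · rintro rfl
      simpa using hl
    · intro hx
      rw [Fin.snoc_castSucc]
      exact hsub i ((ht i).mapsTo hx)
  · have hnot : ∀ y : Fin n, c y.castSucc = c (Fin.last n) → t y ≠ (j, l) := by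
      intro y hy h
      have h1 := (ht _).mapsTo hy
      rw [h, hD] at h1
      simp at h1
    refine Fin.lastCases ?_ (fun x => ?_) x
    · intro hx y
      refine Fin.lastCases (fun _ _ => rfl) (fun y => ?_) y
      intro hy h
      rw [Fin.snoc_last, Fin.snoc_castSucc] at h
      exact absurd h.symm (hnot y (hy.trans hx.symm))
    · intro hx y
      refine Fin.lastCases ?_ (fun y => ?_) y
      · intro hy h
        rw [Fin.snoc_last, Fin.snoc_castSucc] at h
        exact absurd h (hnot x (hx.trans hy.symm))
      · intro hy h
        rw [Fin.snoc_castSucc, Fin.snoc_castSucc] at h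
        rw [(ht i).injOn hx hy h]
  · by_cases hbl : i = c (Fin.last n) ∧ b = (j, l)
    · exact ⟨Fin.last n, hbl.1.symm, by simp [hbl.2]⟩
    · have hb' : b ∈ (D' i).cells := by
        by_cases hi : i = c (Fin.last n)
        · subst hi
          rw [hD]
          exact mem_erase.2 ⟨fun h => hbl ⟨rfl, h⟩, hb⟩
        · rw [hne i hi]; exact hb
      obtain ⟨x, hx, rfl⟩ := (ht i).surjOn hb'
      exact ⟨x.castSucc, hx, by simp⟩

lemma sign_viaEmbedding_castSucc (σ : Equiv.Perm (Fin n)) :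
    Equiv.Perm.sign (Equiv.Perm.viaEmbedding σ Fin.castSuccEmb) = Equiv.Perm.sign σ := by
  rw [Equiv.Perm.viaEmbedding, Equiv.Perm.sign_extendDomain]

lemma viaEmbedding_castSucc (σ : Equiv.Perm (Fin n)) (x : Fin n) :
    Equiv.Perm.viaEmbedding σ Fin.castSuccEmb x.castSucc = (σ x).castSucc :=
  Equiv.Perm.viaEmbedding_apply σ Fin.castSuccEmb x

lemma viaEmbedding_last (σ : Equiv.Perm (Fin n)) :
    Equiv.Perm.viaEmbedding σ Fin.castSuccEmb (Fin.last n) = Fin.last n :=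
  Equiv.Perm.viaEmbedding_apply_of_notMem _ _ _ (by
    rintro ⟨y, hy⟩
    exact (Fin.castSucc_lt_last y).ne hy)

lemma exists_viaEmbedding_eq {π : Equiv.Perm (Fin (n + 1))} (h : π (Fin.last n) = Fin.last n) :
    ∃ σ : Equiv.Perm (Fin n), Equiv.Perm.viaEmbedding σ Fin.castSuccEmb = π := by
  have h' : π⁻¹ (Fin.last n) = Fin.last n := by rw [Equiv.Perm.inv_eq_iff_eq, h]
  have hne : ∀ τ : Equiv.Perm (Fin (n + 1)), τ (Fin.last n) = Fin.last n →
      ∀ x : Fin n, τ x.castSucc ≠ Fin.last n := by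
    intro τ hτ x hx
    rw [← hτ] at hx
    exact (Fin.castSucc_lt_last x).ne (τ.injective hx)
  refine ⟨⟨fun x => (π x.castSucc).castPred (hne π h x),
    fun x => (π⁻¹ x.castSucc).castPred (hne _ h' x), fun x => by simp, fun x => by simp⟩, ?_⟩
  ext x
  refine Fin.lastCases ?_ (fun x => ?_) x
  · rw [viaEmbedding_last, h]
  · rw [viaEmbedding_castSucc]
    simp

/-- The slices of the polytabloid of a filling whose last point is at the foot of its column. -/
lemma slice_polyFun_snoc {c : Fin (n + 1) → ι} {D : ι → YoungDiagram} {j l : ℕ}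
    {t : Fin n → ℕ × ℕ} (hfoot : ∀ j', (j', l) ∈ (D (c (Fin.last n))).cells → j' ≤ j)
    (ht : IsFilling c D (Fin.snoc (α := fun _ => ℕ × ℕ) t (j, l))) :
    slice j (polyFun k c (Fin.snoc (α := fun _ => ℕ × ℕ) t (j, l))) =
        polyFun k (fun x => c x.castSucc) t ∧
      ∀ j' > j, slice j' (polyFun k c (Fin.snoc (α := fun _ => ℕ × ℕ) t (j, l))) = 0 := by
  set t' : Fin (n + 1) → ℕ × ℕ := Fin.snoc (α := fun _ => ℕ × ℕ) t (j, l) with ht'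
  have hlast : t' (Fin.last n) = (j, l) := by simp [ht']
  -- The point `y` carried by `π` to the last point lies in row `j'` of column `l`. The foot of that
  -- column is in row `j`, so `j' ≤ j`, and equality forces `y` to be the last point.
  have key : ∀ π ∈ columnPerms c t', ∀ j' r,
      (∀ x, Fin.snoc (α := fun _ => ℕ) r j' (π x) = (t' x).1) →
      j' ≤ j ∧ (j' = j → π (Fin.last n) = Fin.last n) := by
    intro π hπ j' r h
    obtain ⟨y, hy⟩ := π.surjective (Fin.last n)
    have h1 := mem_columnPerms.1 hπ y
    have h2 := h y
    rw [hy, hlast] at h1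
    rw [hy, Fin.snoc_last] at h2
    have hty : t' y = (j', l) := Prod.ext h2.symm h1.2.symm
    have hbox := (ht _).mapsTo h1.1.symm
    rw [hty] at hbox
    refine ⟨hfoot j' hbox, ?_⟩
    rintro rfl
    have := (ht _).injOn h1.1.symm rfl (hty.trans hlast.symm)
    rwa [this] at hy
  constructor
  · ext r
    rw [slice_apply, polyFun, polyFun]
    symm
    refine sum_bij_ne_zero (fun σ _ _ => Equiv.Perm.viaEmbedding σ Fin.castSuccEmb) ?_ ?_ ?_ ?_
    · intro σ hσ _
      refine mem_columnPerms.2 fun x => ?_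
      refine Fin.lastCases ?_ (fun x => ?_) x
      · rw [viaEmbedding_last]; exact ⟨rfl, rfl⟩
      · rw [viaEmbedding_castSucc]
        simpa [ht'] using mem_columnPerms.1 hσ x
    · intro σ _ _ τ _ _ h
      exact Equiv.Perm.viaEmbeddingHom_injective (Fin.castSuccEmb (n := n)) h
    · intro π hπ h0
      have h1 : ∀ x, Fin.snoc (α := fun _ => ℕ) r j (π x) = (t' x).1 := by
        by_contra h1
        simp [h1] at h0
      obtain ⟨σ, rfl⟩ := exists_viaEmbedding_eq ((key π hπ j r h1).2 rfl)
      refine ⟨σ, ?_, ?_, rfl⟩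
      · refine mem_columnPerms.2 fun x => ?_
        have := mem_columnPerms.1 hπ x.castSucc
        rw [viaEmbedding_castSucc] at this
        simpa [ht'] using this
      · have h2 : ∀ x, r (σ x) = (t x).1 := fun x => by
          have := h1 x.castSucc
          rw [viaEmbedding_castSucc] at this
          simpa [ht'] using this
        rw [if_pos h2]
        rwa [if_pos h1, sign_viaEmbedding_castSucc] at h0
    · intro σ _ _
      rw [sign_viaEmbedding_castSucc]
      congr 1
      rw [Fin.forall_fin_succ', viaEmbedding_last, hlast]
      simp [viaEmbedding_castSucc, ht']
  · intro j' hj'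
    ext r
    rw [slice_apply, polyFun]
    refine sum_eq_zero fun π hπ => if_neg fun h => ?_
    have := (key π hπ j' r h).1
    omega

/-- The span of the polytabloids of all fillings of the diagrams `D`. -/
def polySpan (k : Type*) [Field k] (c : Fin n → ι) (D : ι → YoungDiagram) :
    Submodule k ((Fin n → ℕ) → k) :=
  Submodule.span k {F | ∃ t, IsFilling c D t ∧ polyFun k c t = F}

lemma polySpan_le_highestWeight (c : Fin n → ι) (D : ι → YoungDiagram) :
    polySpan k c D ≤ highestWeight k c (rowLengths D) := by
  rw [polySpan, Submodule.span_le]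
  rintro _ ⟨t, ht, rfl⟩
  exact polyFun_mem_highestWeight ht

/-- Put the last point into the removed box. That box is at the foot of its column, so the new
polytabloid has the old one as its leading slice; then extend linearly. -/
lemma exists_slice_eq_of_mem_polySpan {c : Fin (n + 1) → ι} {D' D : ι → YoungDiagram} {j : ℕ}
    (h : IsRemoveRow D' D (c (Fin.last n)) j) {H : (Fin n → ℕ) → k}
    (hH : H ∈ polySpan k (fun x => c x.castSucc) D') :
    ∃ G ∈ polySpan k c D, slice j G = H ∧ ∀ j' > j, slice j' G = 0 := by
  obtain ⟨l, hl, hD, hfoot, hne⟩ := h.col_le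
  induction hH using Submodule.span_induction with
  | mem H hH =>
    obtain ⟨t, ht, rfl⟩ := hH
    have ht' := IsFilling.snoc hl hD hne ht
    exact ⟨_, Submodule.subset_span ⟨_, ht', rfl⟩, slice_polyFun_snoc hfoot ht'⟩
  | zero => exact ⟨0, zero_mem _, map_zero _, fun _ _ => map_zero _⟩
  | add H₁ H₂ _ _ h₁ h₂ =>
    obtain ⟨G₁, hG₁, e₁, z₁⟩ := h₁
    obtain ⟨G₂, hG₂, e₂, z₂⟩ := h₂
    exact ⟨G₁ + G₂, add_mem hG₁ hG₂, by rw [map_add, e₁, e₂],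
      fun j' hj' => by rw [map_add, z₁ j' hj', z₂ j' hj', add_zero]⟩
  | smul a H _ hH =>
    obtain ⟨G, hG, e, z⟩ := hH
    exact ⟨a • G, Submodule.smul_mem _ _ hG, by rw [map_smul, e],
      fun j' hj' => by rw [map_smul, z j' hj', smul_zero]⟩

/-- If the leading slice of a highest weight vector is nonzero, then it is at a removable box. -/
lemma exists_isRemoveRow_of_slice_ne_zero {c : Fin (n + 1) → ι} {D : ι → YoungDiagram} {j : ℕ}
    {F : (Fin (n + 1) → ℕ) → k} (hF : F ∈ highestWeight k c (rowLengths D))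
    (hj : slice (j + 1) F = 0) (h0 : slice j F ≠ 0) :
    ∃ D', IsRemoveRow D' D (c (Fin.last n)) j := by
  obtain ⟨r, hr⟩ := Function.ne_iff.1 h0
  have ha : ∀ i l, rowLengths D i l = content (fun x => c x.castSucc) r i l +
      if i = c (Fin.last n) ∧ l = j then 1 else 0 := by
    intro i l
    rw [← content_snoc, hF.1 _ hr]
  refine exists_isRemoveRow (fun l => ?_) ha
  by_contra hlt
  exact h0 (highestWeight_eq_zero (not_le.1 hlt) (slice_mem_highestWeight ha hF hj))

/-- The last point cannot lie in a row of length zero of its own diagram. This is what guarantees a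
leading slice. -/
lemma exists_forall_slice_eq_zero {c : Fin (n + 1) → ι} {D : ι → YoungDiagram}
    {F : (Fin (n + 1) → ℕ) → k} (hF : F ∈ highestWeight k c (rowLengths D)) :
    ∃ J, ∀ j ≥ J, slice j F = 0 := by
  refine ⟨(D (c (Fin.last n))).colLen 0, fun j hj => ?_⟩
  ext r
  by_contra h0
  have h1 := congrFun (congrFun (hF.1 _ h0) (c (Fin.last n))) j
  rw [content_snoc, if_pos ⟨rfl, rfl⟩] at h1
  have h2 : ((j, 0) : ℕ × ℕ) ∈ D (c (Fin.last n)) := by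
    rw [YoungDiagram.mem_iff_lt_rowLen]
    simp only [rowLengths] at h1
    omega
  rw [YoungDiagram.mem_iff_lt_colLen] at h2
  omega

/-- The polytabloids span the space of highest weight vectors: the Specht modules are cut out of
the permutation modules by the raising operators. -/
theorem highestWeight_eq_polySpan (c : Fin n → ι) (D : ι → YoungDiagram) :
    highestWeight k c (rowLengths D) = polySpan k c D := by
  refine le_antisymm ?_ (polySpan_le_highestWeight c D)
  induction n generalizing D with
  | zero =>
    intro F hF
    by_cases h0 : F = 0
    · rw [h0]; exact zero_mem _
    obtain ⟨r, hr⟩ := Function.ne_iff.1 h0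
    -- With no points, a nonzero vector has weight zero, so all the diagrams are empty and the empty
    -- filling is admissible.
    have hfill : IsFilling c D (fun _ => 0) := by
      intro i
      refine ⟨fun x => x.elim0, fun x => x.elim0, fun b hb => ?_⟩
      have h1 := congrFun (congrFun (hF.1 _ hr) i) b.1
      have h2 := YoungDiagram.mem_iff_lt_rowLen.1
        ((YoungDiagram.mem_cells (μ := D i) (c := (b.1, b.2))).1 hb)
      simp only [content, univ_eq_empty, filter_empty, card_empty, rowLengths] at h1
      omega
    have hF' : F = F r • polyFun k c (fun _ => 0) := by
      ext q
      rw [Subsingleton.elim q r, Pi.smul_apply]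
      have : polyFun k c (fun _ => 0) r = 1 := by
        have hu : columnPerms c (fun _ : Fin 0 => (0 : ℕ × ℕ)) = {1} := by
          ext π; simp [Subsingleton.elim π 1, columnPerms]
        simp [polyFun, hu]
      rw [this, smul_eq_mul, mul_one]
    rw [hF']
    exact Submodule.smul_mem _ _ (Submodule.subset_span ⟨_, hfill, rfl⟩)
  | succ n ih =>
    -- `J` bounds the rows of the nonzero slices. Subtracting a lift of the top slice lowers the
    -- bound without leaving the highest weight space.
    have key : ∀ J, ∀ F ∈ highestWeight k c (rowLengths D), (∀ j ≥ J, slice j F = 0) →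
        F ∈ polySpan k c D := by
      intro J
      induction J with
      | zero =>
        intro F _ h
        rw [eq_zero_of_slice_eq_zero fun j => h j (Nat.zero_le _)]
        exact zero_mem _
      | succ J ihJ =>
        intro F hF h
        by_cases h0 : slice J F = 0
        · refine ihJ F hF fun j hj => ?_
          rcases hj.eq_or_lt with rfl | hj
          · exact h0
          · exact h j hj
        obtain ⟨D', hD'⟩ := exists_isRemoveRow_of_slice_ne_zero hF (h _ le_rfl) h0
        have h1 := ih (fun x => c x.castSucc) D'
          (slice_mem_highestWeight hD'.rowLengths_eq hF (h _ le_rfl))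
        obtain ⟨G, hG, e, z⟩ := exists_slice_eq_of_mem_polySpan hD' h1
        have h2 := ihJ (F - G) (sub_mem hF (polySpan_le_highestWeight c D hG)) fun j hj => by
          rw [map_sub]
          rcases hj.eq_or_lt with rfl | hj
          · rw [e, sub_self]
          · rw [h j hj, z j hj, sub_zero]
        simpa using add_mem h2 hG
    intro F hF
    obtain ⟨J, hJ⟩ := exists_forall_slice_eq_zero hF
    exact key J F hF hJ

end Slices

/-! ### Coordinates of tabloids and products of polytabloids -/

section FiberPerm

variable {X ι : Type*} (c : X → ι)

/-- The permutation of `X` assembled from permutations of the fibres of `c`. -/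
def fiberPerm : (∀ i, Equiv.Perm {x // c x = i}) →* Equiv.Perm X :=
  (Equiv.sigmaFiberEquiv c).permCongrHom.toMonoidHom.comp (Equiv.Perm.sigmaCongrRightHom _)

lemma fiberPerm_apply (p : ∀ i, Equiv.Perm {x // c x = i}) (x : X) :
    fiberPerm c p x = p (c x) ⟨x, rfl⟩ := rfl

lemma fiberPerm_apply_of_eq (p : ∀ i, Equiv.Perm {x // c x = i}) {x : X} {i : ι} (h : c x = i) :
    fiberPerm c p x = p i ⟨x, h⟩ := by
  subst h
  rfl

/-- Both sides are homomorphisms on a product of groups, so it is enough to compare them on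
permutations of a single fibre. -/
lemma sign_fiberPerm [Fintype X] [DecidableEq X] [Fintype ι] [DecidableEq ι]
    (p : ∀ i, Equiv.Perm {x // c x = i}) :
    Equiv.Perm.sign (fiberPerm c p) = ∏ i, Equiv.Perm.sign (p i) := by
  suffices h : Equiv.Perm.sign.comp (fiberPerm c) =
      ∏ i, Equiv.Perm.sign.comp (Pi.evalMonoidHom (fun i => Equiv.Perm {x // c x = i}) i) by
    have := DFunLike.congr_fun h p
    simpa [MonoidHom.finsetProd_apply] using this
  refine MonoidHom.pi_ext fun i π => ?_
  have h1 : fiberPerm c (Pi.mulSingle i π) = Equiv.Perm.ofSubtype π := by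
    ext x
    by_cases hx : c x = i
    · rw [fiberPerm_apply_of_eq c _ hx, Pi.mulSingle_eq_same]
      exact (Equiv.Perm.ofSubtype_apply_of_mem (p := fun x => c x = i) π hx).symm
    · rw [fiberPerm_apply, Pi.mulSingle_eq_of_ne hx]
      exact (Equiv.Perm.ofSubtype_apply_of_not_mem (p := fun x => c x = i) π hx).symm
  rw [MonoidHom.comp_apply, h1, Equiv.Perm.sign_ofSubtype, MonoidHom.finsetProd_apply,
    Finset.prod_eq_single i]
  · simp
  · intro j _ hj
    simp [Pi.mulSingle_eq_of_ne hj]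
  · simp

end FiberPerm

/-! ### Tabloids as row functions -/

section TabloidCoord

variable {X : Type*} [Fintype X] {lam : YoungDiagram} {k : Type*} [Field k]

/-- The coefficient at the tabloid whose row function is `q`, and zero if there is no such
tabloid. -/
def tabloidCoord (q : X → ℕ) : MonoidAlgebra k (Tabloid X lam) →ₗ[k] k :=
  Finsupp.lapply q ∘ₗ Finsupp.lmapDomain k k Subtype.val ∘ₗ
    (MonoidAlgebra.coeffLinearEquiv k).toLinearMap

lemma tabloidCoord_apply (q : X → ℕ) (w : MonoidAlgebra k (Tabloid X lam)) :
    tabloidCoord q w = Finsupp.mapDomain Subtype.val w.coeff q := rfl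

lemma tabloidCoord_val (T : Tabloid X lam) (w : MonoidAlgebra k (Tabloid X lam)) :
    tabloidCoord T.1 w = w.coeff T := by
  rw [tabloidCoord_apply, Finsupp.mapDomain_apply Subtype.val_injective]

open Classical in
lemma tabloidCoord_single (q : X → ℕ) (T : Tabloid X lam) (a : k) :
    tabloidCoord q (MonoidAlgebra.single T a) = if T.1 = q then a else 0 := by
  rw [tabloidCoord_apply, MonoidAlgebra.coeff_single, Finsupp.mapDomain_single,
    Finsupp.single_apply]

lemma tabloidCoord_ofMulAction (q : X → ℕ) (σ : Equiv.Perm X)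
    (w : MonoidAlgebra k (Tabloid X lam)) :
    tabloidCoord q (Representation.ofMulAction k (Equiv.Perm X) (Tabloid X lam) σ w) =
      tabloidCoord (fun x => q (σ x)) w := by
  classical
  induction w using MonoidAlgebra.induction_linear with
  | zero => simp
  | add w w' h h' => rw [map_add, map_add, map_add, h, h']
  | single T a =>
    rw [Representation.ofMulAction_single, tabloidCoord_single, tabloidCoord_single]
    congr 1
    rw [eq_iff_iff]
    constructor
    · rintro rfl
      ext x
      change T.1 x = T.1 (σ⁻¹ (σ x))
      simp
    · intro h
      ext x
      change T.1 (σ⁻¹ x) = q x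
      rw [h]
      simp

lemma tabloidCoord_polytabloid [DecidableEq X] (q : X → ℕ) (t : Tableau X lam) :
    tabloidCoord q (polytabloid k t) = ∑ π ∈ t.colStab,
      if ∀ x, q (π x) = t.rowOf x then (((Equiv.Perm.sign π : ℤˣ) : ℤ) : k) else 0 := by
  classical
  rw [polytabloid, map_sum]
  refine Finset.sum_congr rfl fun π _ => ?_
  rw [tabloidCoord_single]
  congr 1
  rw [eq_iff_iff]
  constructor
  · rintro rfl x
    change t.rowOf (π⁻¹ (π x)) = _
    simp
  · intro h
    ext x
    change t.rowOf (π⁻¹ x) = q x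
    rw [← h]
    simp

end TabloidCoord

/-! ### Tableaux on the colour classes and coloured polytabloids -/

section Product

open Finset

variable {X ι : Type*} {c : X → ι} {D : ι → YoungDiagram}

/-- The coloured filling assembled from tableaux on the colour classes. -/
def joinTableaux (t : ∀ i, Tableau {x // c x = i} (D i)) (x : X) : ℕ × ℕ :=
  ((t (c x)).symm ⟨x, rfl⟩).1

lemma joinTableaux_of_eq (t : ∀ i, Tableau {x // c x = i} (D i)) {x : X} {i : ι} (h : c x = i) :
    joinTableaux t x = ((t i).symm ⟨x, h⟩).1 := by
  subst h
  rfl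

lemma isFilling_joinTableaux (t : ∀ i, Tableau {x // c x = i} (D i)) :
    IsFilling c D (joinTableaux t) := by
  intro i
  refine ⟨fun x hx => ?_, fun x hx y hy h => ?_, fun b hb => ?_⟩
  · rw [joinTableaux_of_eq t hx]
    exact ((t i).symm ⟨x, hx⟩).2
  · rw [joinTableaux_of_eq t hx, joinTableaux_of_eq t hy] at h
    exact congrArg Subtype.val ((t i).symm.injective (Subtype.ext h))
  · refine ⟨(t i ⟨b, hb⟩).1, (t i ⟨b, hb⟩).2, ?_⟩
    rw [joinTableaux_of_eq t (t i ⟨b, hb⟩).2]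
    simp

lemma exists_joinTableaux_eq {t : X → ℕ × ℕ} (ht : IsFilling c D t) :
    ∃ t' : ∀ i, Tableau {x // c x = i} (D i), joinTableaux t' = t :=
  ⟨fun i => (Set.BijOn.equiv t (ht i)).symm, rfl⟩

/-- A product of polytabloids on the colour classes is a coloured polytabloid. -/
theorem prod_tabloidCoord_polytabloid [Fintype X] [DecidableEq X] [Fintype ι] [DecidableEq ι]
    (k : Type*) [Field k] (t : ∀ i, Tableau {x // c x = i} (D i)) (r : X → ℕ) :
    ∏ i, tabloidCoord (fun x : {x // c x = i} => r x) (polytabloid k (t i)) =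
      polyFun k c (joinTableaux t) r := by
  simp only [tabloidCoord_polytabloid]
  rw [prod_univ_sum, polyFun]
  refine sum_bij (fun p _ => fiberPerm c p) ?_ ?_ ?_ ?_
  · intro p hp
    refine mem_columnPerms.2 fun x => ?_
    have h1 := (mem_filter.1 (Fintype.mem_piFinset.1 hp (c x))).2 ⟨x, rfl⟩
    have h2 : c (fiberPerm c p x) = c x := (p (c x) ⟨x, rfl⟩).2
    refine ⟨h2, ?_⟩
    rw [joinTableaux_of_eq t h2]
    exact h1
  · intro p _ p' _ h
    ext i x
    have := DFunLike.congr_fun h x.1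
    rwa [fiberPerm_apply_of_eq c p x.2, fiberPerm_apply_of_eq c p' x.2] at this
  · intro π hπ
    have hπ := mem_columnPerms.1 hπ
    refine ⟨fun i => π.subtypePerm fun x => by rw [(hπ x).1], ?_, ?_⟩
    · refine Fintype.mem_piFinset.2 fun i => mem_filter.2 ⟨mem_univ _, fun x => ?_⟩
      have h1 := (hπ x).2
      rw [joinTableaux_of_eq t x.2, joinTableaux_of_eq t ((hπ x).1.trans x.2)] at h1
      exact h1
    · ext x
      rfl
  · intro p _
    have hiff : (∀ x, r (fiberPerm c p x) = (joinTableaux t x).1) ↔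
        ∀ i (x : {x // c x = i}), r (p i x) = (t i).rowOf x := by
      constructor
      · intro h i x
        have := h x
        rwa [fiberPerm_apply_of_eq c p x.2, joinTableaux_of_eq t x.2] at this
      · intro h x
        exact h (c x) ⟨x, rfl⟩
    simp only [hiff]
    rw [prod_ite_zero]
    simp only [mem_univ, true_implies]
    split_ifs
    · rw [sign_fiberPerm]
      simp
    · rfl

end Product

/-! ### Tensor powers with rows -/

section RowTensor

variable {k : Type*} [Field k] {G : Type*} [Group G] {s : ℕ} {V : Fin s → Type*}
  [∀ i, AddCommGroup (V i)] [∀ i, Module k (V i)]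

/-- The direct sum of finitely many representations. -/
def sumRep (Y : ∀ i, Representation k G (V i)) : Representation k G (∀ i, V i) where
  toFun g := LinearMap.pi fun i => Y i g ∘ₗ LinearMap.proj i
  map_one' := by ext; simp
  map_mul' g h := by ext; simp

lemma sumRep_single (Y : ∀ i, Representation k G (V i)) (g : G) (i : Fin s) (v : V i) :
    sumRep Y g (Pi.single i v) = Pi.single i (Y i g v) := by
  ext j
  change Y j g (Pi.single i v j) = _
  by_cases h : j = i
  · subst h; simp
  · simp [Pi.single_eq_of_ne h]

variable (k V) in
/-- The functions of rows with values in the tensor power of the direct sum of the `V i`. -/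
abbrev RowTensor (X : Type*) : Type _ := (X → ℕ) → ⨂[k] _ : X, (∀ i, V i)

/-- The wreath product acts on the tensor power and permutes the rows. -/
def rowTensorRep (X : Type*) (Y : ∀ i, Representation k G (V i)) :
    Representation k (Wreath G X) (RowTensor k V X) where
  toFun a :=
    { toFun := fun F r => tensorPowerRep X (sumRep Y) a (F fun x => r (a.right x))
      map_add' := fun F F' => by ext r; simp
      map_smul' := fun t F => by ext r; simp }
  map_one' := by
    ext F r
    simp
  map_mul' a b := by
    ext F r
    simp

lemma rowTensorRep_apply {X : Type*} (Y : ∀ i, Representation k G (V i)) (a : Wreath G X)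
    (F : RowTensor k V X) (r : X → ℕ) :
    rowTensorRep X Y a F r = tensorPowerRep X (sumRep Y) a (F fun x => r (a.right x)) := rfl

lemma tensorPowerRep_tprod {X : Type*} {U : Type*} [AddCommGroup U] [Module k U]
    (ρ : Representation k G U) (a : Wreath G X) (v : X → U) :
    tensorPowerRep X ρ a (PiTensorProduct.tprod k v) =
      PiTensorProduct.tprod k fun x => ρ (a.left x) (v (a.right⁻¹ x)) := by
  change PiTensorProduct.map (fun x => ρ (a.left x))
    (PiTensorProduct.reindex k (fun _ => U) a.right (PiTensorProduct.tprod k v)) = _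
  rw [PiTensorProduct.reindex_tprod, PiTensorProduct.map_tprod]
  rfl

variable {B : Fin s → Type*} (b : ∀ i, Module.Basis (B i) k (V i))

/-- The basis of the tensor power given by bases of the `V i`. -/
def tensorBasis (X : Type*) [Finite X] :
    Module.Basis (X → Σ i, B i) k (⨂[k] _ : X, (∀ i, V i)) :=
  Basis.piTensorProduct fun _ => Pi.basis b

/-- The coefficient of a basis tensor, as a function of the rows. -/
def rowCoord {X : Type*} [Finite X] (β : X → Σ i, B i) :
    RowTensor k V X →ₗ[k] ((X → ℕ) → k) :=
  LinearMap.pi fun r => (tensorBasis b X).coord β ∘ₗ LinearMap.proj r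

lemma rowCoord_apply {X : Type*} [Finite X] (β : X → Σ i, B i) (F : RowTensor k V X)
    (r : X → ℕ) : rowCoord b β F r = (tensorBasis b X).repr (F r) β := rfl

lemma rowTensor_ext {X : Type*} [Finite X] {F F' : RowTensor k V X}
    (h : ∀ β, rowCoord b β F = rowCoord b β F') : F = F' := by
  ext r
  exact (tensorBasis b X).ext_elem fun β => congrFun (h β) r

/-- Permutations merely permute the basis tensors, whereas the base group mixes them. Permutations
suffice for separating cosets, since each coset of `G ≀ S_γ` has a representative in `S_n`. -/
lemma rowCoord_rowTensorRep_inr {X : Type*} [Fintype X] (Y : ∀ i, Representation k G (V i))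
    (σ : Equiv.Perm X) (β : X → Σ i, B i) (F : RowTensor k V X) (r : X → ℕ) :
    rowCoord b β (rowTensorRep X Y (SemidirectProduct.inr σ) F) r =
      rowCoord b (fun x => β (σ x)) F fun x => r (σ x) := by
  rw [rowCoord_apply, rowCoord_apply, rowTensorRep_apply, SemidirectProduct.right_inr]
  generalize F (fun x => r (σ x)) = z
  suffices h : (tensorBasis b X).coord β ∘ₗ tensorPowerRep X (sumRep Y) (SemidirectProduct.inr σ)
      = (tensorBasis b X).coord fun x => β (σ x) from LinearMap.congr_fun h z
  refine PiTensorProduct.ext (MultilinearMap.ext fun v => ?_)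
  change (tensorBasis b X).repr (tensorPowerRep X (sumRep Y) _ (PiTensorProduct.tprod k v)) β =
    (tensorBasis b X).repr (PiTensorProduct.tprod k v) _
  rw [tensorPowerRep_tprod, tensorBasis, Basis.piTensorProduct_repr_tprod_apply,
    Basis.piTensorProduct_repr_tprod_apply, ← Equiv.prod_comp σ]
  simp

/-- The vectors whose coefficients are highest weight vectors of weight `η`. -/
def highestWeightTensor {n : ℕ} (η : Multipartition s n) : Submodule k (RowTensor k V (Fin n)) :=
  ⨅ β : Fin n → Σ i, B i,
    (highestWeight k (fun x => (β x).1) (rowLengths η.comp)).comap (rowCoord b β)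

lemma mem_highestWeightTensor {n : ℕ} {η : Multipartition s n} {F : RowTensor k V (Fin n)} :
    F ∈ highestWeightTensor b η ↔
      ∀ β, rowCoord b β F ∈ highestWeight k (fun x => (β x).1) (rowLengths η.comp) := by
  simp [highestWeightTensor]

end RowTensor

/-! ### Embedding of the inner modules -/

section Inner

variable {k : Type*} [Field k] {G : Type*} [Group G] {s n : ℕ} (η : Multipartition s n)
  {V : Fin s → Type*} [∀ i, AddCommGroup (V i)] [∀ i, Module k (V i)]

/-- The pure tensors of the inner module. -/
def innerPure (v : ∀ i, η.Block i → V i) (w : ∀ i, SpechtModule (η.Block i) (η.comp i) k) :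
    InnerSpace k η V :=
  (PiTensorProduct.tprod k fun i => PiTensorProduct.tprod k (v i)) ⊗ₜ[k] PiTensorProduct.tprod k w

/-- A polytabloid as an element of the Specht module. -/
def spechtPolytabloid (k : Type*) [Field k] {X : Type*} [Fintype X] [DecidableEq X]
    {lam : YoungDiagram} (t : Tableau X lam) : SpechtModule X lam k :=
  ⟨polytabloid k t, Submodule.subset_span ⟨t, rfl⟩⟩

lemma span_spechtPolytabloid (k : Type*) [Field k] {X : Type*} [Fintype X] [DecidableEq X]
    {lam : YoungDiagram} :
    Submodule.span k (Set.range (spechtPolytabloid k (X := X) (lam := lam))) = ⊤ := by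
  refine Eq.trans (congrArg (Submodule.span k) ?_) (Submodule.span_setOfPred_mem_eq_top (R := k)
    (s := Set.range (polytabloid (X := X) (lam := lam) k)))
  ext w
  constructor
  · rintro ⟨t, rfl⟩
    exact ⟨t, rfl⟩
  · rintro ⟨t, ht⟩
    exact ⟨t, Subtype.ext ht⟩

/-- Polytabloids span the Specht factors and pure tensors span the rest, so identities between
linear maps need checking only on these generators. -/
lemma innerSpace_hom_ext {W : Type*} [AddCommGroup W] [Module k W]
    {f g : InnerSpace k η V →ₗ[k] W}
    (h : ∀ v (t : ∀ i, Tableau (η.Block i) (η.comp i)),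
      f (innerPure η v fun i => spechtPolytabloid k (t i)) =
        g (innerPure η v fun i => spechtPolytabloid k (t i))) : f = g := by
  have key : ∀ (f g : ((⨂[k] i, ⨂[k] _ : η.Block i, V i) ⊗[k]
      (⨂[k] i, SpechtModule (η.Block i) (η.comp i) k)) →ₗ[k] W),
      (∀ v (t : ∀ i, Tableau (η.Block i) (η.comp i)),
        f (innerPure η v fun i => spechtPolytabloid k (t i)) =
        g (innerPure η v fun i => spechtPolytabloid k (t i))) → f = g := by
    intro f g h
    refine TensorProduct.ext ?_
    refine PiTensorProduct.ext_of_span_eq_top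
      (g := fun i => (fun v : η.Block i → V i => PiTensorProduct.tprod k v))
      (fun i => PiTensorProduct.span_tprod_eq_top) fun v => ?_
    refine PiTensorProduct.ext_of_span_eq_top
      (g := fun i => (fun t : Tableau (η.Block i) (η.comp i) => spechtPolytabloid k t))
      (fun i => span_spechtPolytabloid k) fun t => ?_
    exact h v t
  exact key f g h

lemma wreathSpechtInner_innerPure (Y : ∀ i, Representation k G (V i)) (h : wreathYoung G η)
    (v : ∀ i, η.Block i → V i) (w : ∀ i, SpechtModule (η.Block i) (η.comp i) k) :
    wreathSpechtInner η Y h (innerPure η v w) =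
      innerPure η (fun i x => Y i (h.1.left x)
          (v i ((η.youngProj i (wreathYoungRight G η h))⁻¹ x)))
        (fun i => spechtRep (η.Block i) (η.comp i) k (η.youngProj i (wreathYoungRight G η h))
          (w i)) := by
  change (PiTensorProduct.map _ (PiTensorProduct.tprod k fun i => PiTensorProduct.tprod k (v i)))
    ⊗ₜ[k] (PiTensorProduct.map _ (PiTensorProduct.tprod k w)) = _
  rw [PiTensorProduct.map_tprod, PiTensorProduct.map_tprod, innerPure]
  congr 2
  ext i
  exact tensorPowerRep_tprod _ _ _

/-- The vectors on the blocks, regarded as vectors of the direct sum. -/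
def joinVec (v : ∀ i, η.Block i → V i) (x : Fin n) : ∀ i, V i :=
  Pi.single (η.blockIdx x) (v (η.blockIdx x) ⟨x, rfl⟩)

lemma joinVec_of_eq (v : ∀ i, η.Block i → V i) {x : Fin n} {i : Fin s} (h : η.blockIdx x = i) :
    joinVec η v x = Pi.single i (v i ⟨x, h⟩) := by
  subst h
  rfl

variable {B : Fin s → Type*} (b : ∀ i, Module.Basis (B i) k (V i))

/-- The coefficient of a basis tensor in the tensor factor of the inner module. -/
def vecCoord (β : Fin n → Σ i, B i) : (⨂[k] i, ⨂[k] _ : η.Block i, V i) →ₗ[k] k :=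
  PiTensorProduct.lift ((MultilinearMap.mkPiAlgebra k (Fin s) k).compLinearMap fun i =>
    PiTensorProduct.lift ((MultilinearMap.mkPiAlgebra k (η.Block i) k).compLinearMap fun x =>
      (Pi.basis b).coord (β x) ∘ₗ LinearMap.single k V i))

/-- The coefficient of a row function in the product of Specht modules. -/
def spechtCoord (r : Fin n → ℕ) : (⨂[k] i, SpechtModule (η.Block i) (η.comp i) k) →ₗ[k] k :=
  PiTensorProduct.lift ((MultilinearMap.mkPiAlgebra k (Fin s) k).compLinearMap fun i =>
    tabloidCoord (fun x : η.Block i => r x) ∘ₗ Submodule.subtype _)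

lemma vecCoord_tprod (β : Fin n → Σ i, B i) (v : ∀ i, η.Block i → V i) :
    vecCoord η b β (PiTensorProduct.tprod k fun i => PiTensorProduct.tprod k (v i)) =
      ∏ x, (Pi.basis b).repr (joinVec η v x) (β x) := by
  rw [vecCoord, PiTensorProduct.lift.tprod, MultilinearMap.compLinearMap_apply,
    MultilinearMap.mkPiAlgebra_apply, ← Fintype.prod_fiberwise η.blockIdx]
  refine Finset.prod_congr rfl fun i _ => ?_
  rw [PiTensorProduct.lift.tprod, MultilinearMap.compLinearMap_apply,
    MultilinearMap.mkPiAlgebra_apply]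
  refine Finset.prod_congr rfl fun x _ => ?_
  rw [joinVec_of_eq η v x.2]
  rfl

lemma spechtCoord_tprod (r : Fin n → ℕ) (w : ∀ i, SpechtModule (η.Block i) (η.comp i) k) :
    spechtCoord η r (PiTensorProduct.tprod k w) =
      ∏ i, tabloidCoord (fun x : η.Block i => r x) (w i).1 := by
  rw [spechtCoord, PiTensorProduct.lift.tprod]
  rfl

/-- The coefficients of an element of the inner module. -/
def innerCoord (β : Fin n → Σ i, B i) (r : Fin n → ℕ) : InnerSpace k η V →ₗ[k] k :=
  (LinearMap.mul' k k ∘ₗ TensorProduct.map (vecCoord η b β) (spechtCoord η r) :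
    ((⨂[k] i, ⨂[k] _ : η.Block i, V i) ⊗[k]
      (⨂[k] i, SpechtModule (η.Block i) (η.comp i) k)) →ₗ[k] k)

lemma innerCoord_innerPure (β : Fin n → Σ i, B i) (r : Fin n → ℕ) (v : ∀ i, η.Block i → V i)
    (w : ∀ i, SpechtModule (η.Block i) (η.comp i) k) :
    innerCoord η b β r (innerPure η v w) =
      (∏ x, (Pi.basis b).repr (joinVec η v x) (β x)) *
        ∏ i, tabloidCoord (fun x : η.Block i => r x) (w i).1 := by
  rw [← vecCoord_tprod, ← spechtCoord_tprod]
  rfl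

/-- A vector on block `i` lies in the summand `V i`, so only basis tensors coloured by the blocks
can occur. This gives the translates by different cosets disjoint supports. -/
lemma innerCoord_eq_zero {β : Fin n → Σ i, B i} (h : ¬ ∀ x, (β x).1 = η.blockIdx x)
    (r : Fin n → ℕ) (y : InnerSpace k η V) : innerCoord η b β r y = 0 := by
  suffices h0 : innerCoord η b β r = 0 by rw [h0]; rfl
  refine innerSpace_hom_ext η fun v t => ?_
  push Not at h
  obtain ⟨x, hx⟩ := h
  rw [innerCoord_innerPure, Finset.prod_eq_zero (Finset.mem_univ x), zero_mul]
  · rfl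
  · rw [Pi.basis_repr, joinVec, Pi.single_eq_of_ne hx]
    simp

variable [∀ i, Finite (B i)]

/-- The embedding of the inner module into the tensor power with rows. -/
def innerMap : InnerSpace k η V →ₗ[k] RowTensor k V (Fin n) :=
  LinearMap.pi fun r => (tensorBasis b (Fin n)).equivFun.symm.toLinearMap ∘ₗ
    LinearMap.pi fun β => innerCoord η b β r

lemma rowCoord_innerMap (β : Fin n → Σ i, B i) (r : Fin n → ℕ) (y : InnerSpace k η V) :
    rowCoord b β (innerMap η b y) r = innerCoord η b β r y := by
  rw [rowCoord_apply, ← Module.Basis.equivFun_apply]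
  exact congrFun ((tensorBasis b (Fin n)).equivFun.apply_symm_apply
    (fun β => innerCoord η b β r y)) β

lemma innerMap_innerPure (v : ∀ i, η.Block i → V i)
    (w : ∀ i, SpechtModule (η.Block i) (η.comp i) k) (r : Fin n → ℕ) :
    innerMap η b (innerPure η v w) r =
      (∏ i, tabloidCoord (fun x : η.Block i => r x) (w i).1) •
        PiTensorProduct.tprod k (joinVec η v) := by
  refine (tensorBasis b (Fin n)).ext_elem fun β => ?_
  rw [← rowCoord_apply, rowCoord_innerMap, innerCoord_innerPure, map_smul, Finsupp.smul_apply,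
    tensorBasis, Basis.piTensorProduct_repr_tprod_apply, smul_eq_mul, mul_comm]

lemma innerMap_wreathSpechtInner (Y : ∀ i, Representation k G (V i)) (h : wreathYoung G η)
    (y : InnerSpace k η V) :
    innerMap η b (wreathSpechtInner η Y h y) = rowTensorRep (Fin n) Y h.1 (innerMap η b y) := by
  suffices h0 : innerMap η b ∘ₗ wreathSpechtInner η Y h =
      rowTensorRep (Fin n) Y h.1 ∘ₗ innerMap η b from LinearMap.congr_fun h0 y
  refine innerSpace_hom_ext η fun v t => ?_
  ext r
  rw [LinearMap.comp_apply, LinearMap.comp_apply, wreathSpechtInner_innerPure,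
    innerMap_innerPure, rowTensorRep_apply, innerMap_innerPure, map_smul, tensorPowerRep_tprod]
  have hσ : ∀ x, η.blockIdx (h.1.right⁻¹ x) = η.blockIdx x :=
    (η.youngSubgroup.inv_mem h.2)
  congr 1
  · refine Finset.prod_congr rfl fun i _ => ?_
    exact tabloidCoord_ofMulAction _ _ _
  · congr 1
    ext1 x
    rw [joinVec_of_eq η v (hσ x), sumRep_single]
    rfl

/-- The coordinates at block-coloured basis tensors are those of the tensor product of the `V i`
with the permutation modules on tabloids. Over a field the Specht modules are direct summands as
vector spaces, so their tensor product embeds there. -/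
lemma innerMap_injective : Function.Injective (innerMap η b) := by
  classical
  rw [injective_iff_map_eq_zero]
  intro y hy
  have hy' : ∀ β r, innerCoord η b β r y = 0 := by
    intro β r
    rw [← rowCoord_innerMap, hy, map_zero]
    rfl
  have hret : ∀ i, ∃ p : MonoidAlgebra k (Tabloid (η.Block i) (η.comp i)) →ₗ[k]
      SpechtModule (η.Block i) (η.comp i) k, p ∘ₗ Submodule.subtype _ = LinearMap.id :=
    fun i => LinearMap.exists_leftInverse_of_injective _ (Submodule.ker_subtype _)
  choose p hp using hret
  let incl : (⨂[k] i, SpechtModule (η.Block i) (η.comp i) k) →ₗ[k]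
      ⨂[k] i, MonoidAlgebra k (Tabloid (η.Block i) (η.comp i)) :=
    PiTensorProduct.map fun i => Submodule.subtype _
  have hincl : PiTensorProduct.map p ∘ₗ incl = LinearMap.id := by
    rw [← PiTensorProduct.map_comp]
    simp only [hp]
    exact PiTensorProduct.map_id
  let b₁ : Module.Basis (∀ i, η.Block i → B i) k (⨂[k] i, ⨂[k] _ : η.Block i, V i) :=
    Basis.piTensorProduct fun i => Basis.piTensorProduct fun _ => b i
  let b₂ : Module.Basis (∀ i, Tabloid (η.Block i) (η.comp i)) k
      (⨂[k] i, MonoidAlgebra k (Tabloid (η.Block i) (η.comp i))) :=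
    Basis.piTensorProduct fun i => ⟨MonoidAlgebra.coeffLinearEquiv k⟩
  have hv : ∀ β' : ∀ i, η.Block i → B i,
      vecCoord η b (fun x => ⟨η.blockIdx x, β' _ ⟨x, rfl⟩⟩) = b₁.coord β' := by
    intro β'
    refine PiTensorProduct.ext_of_span_eq_top
      (g := fun i => (fun v : η.Block i → V i => PiTensorProduct.tprod k v))
      (fun i => PiTensorProduct.span_tprod_eq_top) fun v => ?_
    rw [vecCoord_tprod, Module.Basis.coord_apply, Basis.piTensorProduct_repr_tprod_apply,
      ← Fintype.prod_fiberwise η.blockIdx]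
    refine Finset.prod_congr rfl fun i _ => ?_
    rw [Basis.piTensorProduct_repr_tprod_apply]
    refine Finset.prod_congr rfl fun x _ => ?_
    obtain ⟨x, rfl⟩ := x
    rw [Pi.basis_repr, joinVec, Pi.single_eq_same]
  have hs : ∀ T : ∀ i, Tabloid (η.Block i) (η.comp i),
      spechtCoord η (fun x => (T (η.blockIdx x)).1 ⟨x, rfl⟩) = b₂.coord T ∘ₗ incl := by
    intro T
    refine PiTensorProduct.ext (MultilinearMap.ext fun w => ?_)
    rw [LinearMap.compMultilinearMap_apply, LinearMap.compMultilinearMap_apply,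
      spechtCoord_tprod, LinearMap.comp_apply, PiTensorProduct.map_tprod,
      Module.Basis.coord_apply, Basis.piTensorProduct_repr_tprod_apply]
    refine Finset.prod_congr rfl fun i _ => ?_
    have : (fun x : η.Block i => (T (η.blockIdx x)).1 ⟨x.1, rfl⟩) = (T i).1 := by
      ext ⟨x, rfl⟩
      rfl
    rw [this, tabloidCoord_val]
    rfl
  -- Each coordinate of this image is an `innerCoord`, taken at the colours of the blocks and at the
  -- row function glued from the tabloids `T i`.
  have h0 : TensorProduct.map LinearMap.id incl y = 0 := by
    refine (b₁.tensorProduct b₂).ext_elem fun ⟨β', T⟩ => ?_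
    rw [map_zero, Finsupp.zero_apply,
      ← hy' (fun x => ⟨η.blockIdx x, β' _ ⟨x, rfl⟩⟩) (fun x => (T (η.blockIdx x)).1 ⟨x, rfl⟩)]
    suffices h : (b₁.tensorProduct b₂).coord (β', T) ∘ₗ TensorProduct.map LinearMap.id incl =
        innerCoord η b (fun x => ⟨η.blockIdx x, β' _ ⟨x, rfl⟩⟩)
          (fun x => (T (η.blockIdx x)).1 ⟨x, rfl⟩) from LinearMap.congr_fun h y
    rw [innerCoord, hv, hs]
    refine TensorProduct.ext' fun u w => ?_
    simp [mul_comm]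
  have h1 := congrArg (TensorProduct.map LinearMap.id (PiTensorProduct.map p)) h0
  have h2 : TensorProduct.map LinearMap.id (PiTensorProduct.map p) ∘ₗ
      TensorProduct.map (LinearMap.id : (⨂[k] i, ⨂[k] _ : η.Block i, V i) →ₗ[k] _) incl =
        LinearMap.id := by
    rw [← TensorProduct.map_comp, hincl, LinearMap.id_comp, TensorProduct.map_id]
  exact (LinearMap.congr_fun h2 y).symm.trans (h1.trans (map_zero _))

end Inner

/-! ### Embedding of the induced modules -/

section Fibres

variable {s n : ℕ} (η : Multipartition s n)

lemma card_block (i : Fin s) : Fintype.card (η.Block i) = (η.comp i).card := by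
  have e : η.Block i ≃ Fin (η.comp i).card :=
    ((((finCongr η.sum_card.symm).trans finSigmaFinEquiv.symm).subtypeEquiv
      (q := fun y : (Σ i, Fin (η.comp i).card) => y.1 = i) fun x => Iff.rfl)).trans
      (Equiv.sigmaSubtype i)
  rw [Fintype.card_congr e, Fintype.card_fin]

/-- A filling determines a permutation carrying the blocks to the colour classes. -/
lemma IsFilling.exists_perm {c : Fin n → Fin s} {t : Fin n → ℕ × ℕ}
    (h : IsFilling c η.comp t) : ∃ σ : Equiv.Perm (Fin n), ∀ x, c (σ x) = η.blockIdx x := by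
  have e : ∀ i, η.Block i ≃ {x // c x = i} := fun i => by
    refine Fintype.equivOfCardEq ?_
    rw [card_block, YoungDiagram.card, ← Fintype.card_coe]
    exact (Fintype.card_congr (Set.BijOn.equiv t (h i))).symm
  refine ⟨(Equiv.sigmaFiberEquiv η.blockIdx).symm.trans
    ((Equiv.sigmaCongrRight e).trans (Equiv.sigmaFiberEquiv c)), fun x => ?_⟩
  exact (e (η.blockIdx x) ⟨x, rfl⟩).2

/-- The colourings obtained from the blocks by a permutation. -/
abbrev BlockColouring : Type :=
  {c : Fin n → Fin s // ∃ σ : Equiv.Perm (Fin n), ∀ x, c (σ x) = η.blockIdx x}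

end Fibres

/-! ### Relabelling the points of a coloured filling -/

section Conjugation

variable {X ι : Type*}

lemma IsFilling.comp_perm {c : X → ι} {D : ι → YoungDiagram} {t : X → ℕ × ℕ}
    (h : IsFilling c D t) (σ : Equiv.Perm X) :
    IsFilling (fun x => c (σ x)) D (fun x => t (σ x)) := by
  intro i
  refine ⟨fun x hx => (h i).mapsTo hx, fun x hx y hy hxy => σ.injective ((h i).injOn hx hy hxy),
    fun b hb => ?_⟩
  obtain ⟨x, hx, rfl⟩ := (h i).surjOn hb
  exact ⟨σ⁻¹ x, by simpa using hx, by simp⟩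

/-- Conjugation by `σ` identifies the two groups of column permutations and preserves signs. It
serves to carry an arbitrary colouring to the one given by the blocks. -/
lemma polyFun_comp_perm [Fintype X] [DecidableEq ι] [DecidableEq X] (k : Type*) [Field k] (c : X → ι) (t : X → ℕ × ℕ)
    (σ : Equiv.Perm X) (r : X → ℕ) :
    polyFun k (fun x => c (σ x)) (fun x => t (σ x)) (fun x => r (σ x)) = polyFun k c t r := by
  refine Finset.sum_bij' (fun π _ => σ * π * σ⁻¹) (fun π _ => σ⁻¹ * π * σ) ?_ ?_ ?_ ?_ ?_
  · intro π hπ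
    refine mem_columnPerms.2 fun x => ?_
    simpa using mem_columnPerms.1 hπ (σ⁻¹ x)
  · intro π hπ
    refine mem_columnPerms.2 fun x => ?_
    simpa using mem_columnPerms.1 hπ (σ x)
  · intro π _
    group
  · intro π _
    group
  · intro π _
    have h1 : (∀ x, r (σ (π x)) = (t (σ x)).1) ↔ ∀ x, r ((σ * π * σ⁻¹) x) = (t x).1 := by
      constructor
      · intro h x
        simpa using h (σ⁻¹ x)
      · intro h x
        simpa using h (σ x)
    simp only [h1]
    congr 1
    simp [mul_comm (Equiv.Perm.sign σ), mul_assoc]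

end Conjugation

/-! ### The induced module as a space of highest weight tensors -/

section Induced

variable {k : Type*} [Field k] {G : Type*} [Group G] {s n : ℕ} (η : Multipartition s n)
  {V : Fin s → Type*} [∀ i, AddCommGroup (V i)] [∀ i, Module k (V i)]
  (Y : ∀ i, Representation k G (V i))
  {B : Fin s → Type*} (b : ∀ i, Module.Basis (B i) k (V i)) [∀ i, Finite (B i)]

/-- The map from the induced module to the tensor power with rows. -/
def wreathSpechtEmb : WreathSpechtSpace η Y →ₗ[k] RowTensor k V (Fin n) :=
  Representation.Coinvariants.lift _
    -- The coinvariants identify `hg ⊗ hy` with `g ⊗ y`, so it is `g⁻¹` that must act on the image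
    -- of `y`.
    (TensorProduct.lift ((Finsupp.lift (InnerSpace k η V →ₗ[k] RowTensor k V (Fin n)) k
      (Wreath G (Fin n)) fun g => rowTensorRep (Fin n) Y g⁻¹ ∘ₗ innerMap η b) ∘ₗ
        (MonoidAlgebra.coeffLinearEquiv k).toLinearMap))
    fun h => by
      refine TensorProduct.ext (MonoidAlgebra.lhom_ext' fun g => LinearMap.ext_ring ?_)
      ext1 y
      simp [Representation.ofMulAction_single, innerMap_wreathSpechtInner]

lemma wreathSpechtEmb_mk (g : Wreath G (Fin n)) (y : InnerSpace k η V) :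
    wreathSpechtEmb η Y b (Representation.IndV.mk (wreathYoung G η).subtype
      (wreathSpechtInner η Y) g y) = rowTensorRep (Fin n) Y g⁻¹ (innerMap η b y) := by
  simp [wreathSpechtEmb]

lemma wreathSpechtEmb_wreathSpechtOf (a : Wreath G (Fin n)) (u : WreathSpechtSpace η Y) :
    wreathSpechtEmb η Y b (wreathSpechtOf η Y a u) =
      rowTensorRep (Fin n) Y a (wreathSpechtEmb η Y b u) := by
  suffices h : wreathSpechtEmb η Y b ∘ₗ wreathSpechtOf η Y a =
      rowTensorRep (Fin n) Y a ∘ₗ wreathSpechtEmb η Y b from LinearMap.congr_fun h u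
  refine Representation.IndV.hom_ext _ _ fun g => LinearMap.ext fun y => ?_
  change wreathSpechtEmb η Y b (Representation.ind _ _ a (Representation.IndV.mk _ _ g y)) =
    rowTensorRep (Fin n) Y a (wreathSpechtEmb η Y b (Representation.IndV.mk _ _ g y))
  rw [Representation.ind_mk, wreathSpechtEmb_mk, wreathSpechtEmb_mk, mul_inv_rev, inv_inv, map_mul]
  rfl

/-- Every element of the induced module is a combination over the cosets of the Young subgroup,
indexed by the colourings they determine. -/
lemma exists_eq_sum_mk
    (σ : BlockColouring η → Equiv.Perm (Fin n))
    (hσ : ∀ (c : BlockColouring η) x, c.1 (σ c x) = η.blockIdx x) (u : WreathSpechtSpace η Y) :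
    ∃ y : BlockColouring η → InnerSpace k η V,
      u = ∑ c, Representation.IndV.mk (wreathYoung G η).subtype (wreathSpechtInner η Y)
        (SemidirectProduct.inr (σ c))⁻¹ (y c) := by
  classical
  set mk := Representation.IndV.mk (wreathYoung G η).subtype (wreathSpechtInner η Y) with hmk
  let Θ : (BlockColouring η → InnerSpace k η V) →ₗ[k] WreathSpechtSpace η Y :=
    ∑ c, mk (SemidirectProduct.inr (σ c))⁻¹ ∘ₗ LinearMap.proj c
  suffices h : LinearMap.range Θ = ⊤ by
    obtain ⟨y, hy⟩ := LinearMap.range_eq_top.1 h u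
    exact ⟨y, by rw [← hy]; simp [Θ]⟩
  rw [← (LinearMap.range Θ).ker_mkQ, LinearMap.ker_eq_top]
  refine Representation.IndV.hom_ext _ _ fun g => LinearMap.ext fun y => ?_
  rw [LinearMap.zero_comp, LinearMap.zero_apply, LinearMap.comp_apply, Submodule.mkQ_apply,
    Submodule.Quotient.mk_eq_zero]
  set τ := g.right with hτ
  -- The coset of `g` is recorded by the blocks pulled back along `τ`. Then `τ * σ c` preserves the
  -- blocks, and `g` differs from `(σ c)⁻¹` by a left factor in `G ≀ S_γ`.
  let c : BlockColouring η :=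
    ⟨fun x => η.blockIdx (τ x), τ⁻¹, fun x => by simp⟩
  have hmem : g * SemidirectProduct.inr (σ c) ∈ wreathYoung G η := fun x => hσ c x
  refine ⟨Pi.single c (wreathSpechtInner η Y ⟨_, hmem⟩⁻¹ y), ?_⟩
  have h1 : Θ (Pi.single c (wreathSpechtInner η Y ⟨_, hmem⟩⁻¹ y)) =
      mk (SemidirectProduct.inr (σ c))⁻¹ (wreathSpechtInner η Y ⟨_, hmem⟩⁻¹ y) := by
    simp only [Θ, LinearMap.sum_apply, LinearMap.comp_apply, LinearMap.proj_apply]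
    rw [Finset.sum_eq_single c, Pi.single_eq_same]
    · intro c' _ hc'
      rw [Pi.single_eq_of_ne hc']
      simp
    · simp
  have h2 := Representation.Coinvariants.mk_self_apply
    (Representation.tprod ((Representation.leftRegular k (Wreath G (Fin n))).comp
      (wreathYoung G η).subtype) (wreathSpechtInner η Y)) (⟨_, hmem⟩⁻¹ : wreathYoung G η)
    (MonoidAlgebra.single g 1 ⊗ₜ y)
  rw [h1, hmk]
  refine Eq.trans ?_ h2
  simp [Representation.ofMulAction_single]

/-- The summand belonging to a colouring `c` involves only basis tensors coloured by `c`. The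
summands can therefore be read off separately, and the question reduces to `innerMap_injective`. -/
lemma wreathSpechtEmb_injective : Function.Injective (wreathSpechtEmb η Y b) := by
  classical
  rw [injective_iff_map_eq_zero]
  intro u hu
  choose σ hσ using fun c : BlockColouring η => c.2
  obtain ⟨y, rfl⟩ := exists_eq_sum_mk η Y σ hσ u
  have hy : ∀ c, y c = 0 := by
    intro c
    refine (injective_iff_map_eq_zero _).1 (innerMap_injective η b) _ ?_
    refine rowTensor_ext b fun β => funext fun r => ?_
    rw [rowCoord_innerMap, map_zero, Pi.zero_apply]
    by_cases hβ : ∀ x, (β x).1 = η.blockIdx x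
    swap
    · exact innerCoord_eq_zero η b hβ r _
    -- If `β` has the colours of the blocks, then `β ∘ (σ c)⁻¹` has the colouring `c`, so at this
    -- coordinate only the summand of `c` contributes.
    have h1 := congrFun (congrArg (rowCoord b fun x => β ((σ c)⁻¹ x)) hu) fun x => r ((σ c)⁻¹ x)
    simp only [map_sum, wreathSpechtEmb_mk, inv_inv, Finset.sum_apply,
      rowCoord_rowTensorRep_inr, rowCoord_innerMap, map_zero, Pi.zero_apply] at h1
    rw [Finset.sum_eq_single c] at h1
    · simpa using h1
    · intro c' _ hne
      refine innerCoord_eq_zero η b (fun h => hne ?_) _ _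
      refine Subtype.ext (funext fun x => ?_)
      have h2 := h ((σ c')⁻¹ x)
      rw [hβ, ← hσ c, ← hσ c'] at h2
      simpa using h2.symm
    · simp
  simp [hy]

lemma rowCoord_rowTensorRep_innerMap (a : Wreath G (Fin n)) (v : ∀ i, η.Block i → V i)
    (t : ∀ i, Tableau (η.Block i) (η.comp i)) (β : Fin n → Σ i, B i) (r : Fin n → ℕ) :
    rowCoord b β (rowTensorRep (Fin n) Y a
      (innerMap η b (innerPure η v fun i => spechtPolytabloid k (t i)))) r =
    (∏ x, (Pi.basis b).repr (sumRep Y (a.left x) (joinVec η v (a.right⁻¹ x))) (β x)) *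
      polyFun k (fun x => η.blockIdx (a.right⁻¹ x)) (fun x => joinTableaux t (a.right⁻¹ x)) r := by
  rw [rowCoord_apply, rowTensorRep_apply, innerMap_innerPure, map_smul, tensorPowerRep_tprod,
    map_smul, Finsupp.smul_apply, tensorBasis, Basis.piTensorProduct_repr_tprod_apply,
    smul_eq_mul, mul_comm]
  congr 1
  refine (prod_tabloidCoord_polytabloid k t fun x => r (a.right x)).trans ?_
  rw [← polyFun_comp_perm k (fun x => η.blockIdx (a.right⁻¹ x)) _ a.right]
  simp

/-- The base group acts inside each `V i` and so preserves colours. Hence each coefficient of a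
translated generator is zero or a scalar multiple of the polytabloid of a translated filling. -/
lemma range_wreathSpechtEmb_le :
    LinearMap.range (wreathSpechtEmb η Y b) ≤ highestWeightTensor b η := by
  suffices h : (highestWeightTensor b η).mkQ ∘ₗ wreathSpechtEmb η Y b = 0 by
    rintro _ ⟨u, rfl⟩
    rw [← Submodule.Quotient.mk_eq_zero]
    exact LinearMap.congr_fun h u
  refine Representation.IndV.hom_ext _ _ fun g => innerSpace_hom_ext η fun v t => ?_
  rw [LinearMap.zero_comp, LinearMap.zero_apply]
  refine (Submodule.Quotient.mk_eq_zero _).2 ?_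
  rw [wreathSpechtEmb_mk, mem_highestWeightTensor]
  generalize g⁻¹ = a
  intro β
  set F := rowCoord b β (rowTensorRep (Fin n) Y a
      (innerMap η b (innerPure η v fun i => spechtPolytabloid k (t i)))) with hF
  have h1 : F = (∏ x, (Pi.basis b).repr (sumRep Y (a.left x) (joinVec η v (a.right⁻¹ x))) (β x)) •
      polyFun k (fun x => η.blockIdx (a.right⁻¹ x)) (fun x => joinTableaux t (a.right⁻¹ x)) :=
    funext fun r => rowCoord_rowTensorRep_innerMap η Y b a v t β r
  by_cases hβ : ∀ x, (β x).1 = η.blockIdx (a.right⁻¹ x)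
  · rw [h1]
    simp only [hβ]
    exact Submodule.smul_mem _ _
      (polyFun_mem_highestWeight ((isFilling_joinTableaux t).comp_perm a.right⁻¹))
  · push Not at hβ
    obtain ⟨x, hx⟩ := hβ
    rw [h1, Finset.prod_eq_zero (Finset.mem_univ x), zero_smul]
    · exact zero_mem _
    · rw [Pi.basis_repr, joinVec, sumRep_single, Pi.single_eq_of_ne hx]
      simp

/-- The multiples of a basis tensor by functions of the rows. -/
def rowTensorSingle (β : Fin n → Σ i, B i) : ((Fin n → ℕ) → k) →ₗ[k] RowTensor k V (Fin n) where
  toFun H r := H r • tensorBasis b (Fin n) β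
  map_add' H H' := by ext r; simp [add_smul]
  map_smul' a H := by ext r; simp [mul_smul]

/-- A filling for the colours of `β` is carried by a permutation to one for the blocks, that is, to
a family of tableaux. Its polytabloids, tensored with the permuted basis vectors of `β`, form a
generator of the inner module whose translate is the required vector. -/
lemma rowTensorSingle_mem_range {β : Fin n → Σ i, B i} {H : (Fin n → ℕ) → k}
    (hH : H ∈ polySpan k (fun x => (β x).1) η.comp) :
    rowTensorSingle b β H ∈ LinearMap.range (wreathSpechtEmb η Y b) := by
  suffices h : polySpan k (fun x => (β x).1) η.comp ≤
      (LinearMap.range (wreathSpechtEmb η Y b)).comap (rowTensorSingle b β) from h hH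
  rw [polySpan, Submodule.span_le]
  rintro _ ⟨t, ht, rfl⟩
  obtain ⟨σ, hσ⟩ := ht.exists_perm
  have ht' := ht.comp_perm σ
  rw [funext hσ] at ht'
  obtain ⟨t', h'⟩ := exists_joinTableaux_eq ht'
  refine ⟨Representation.IndV.mk (wreathYoung G η).subtype (wreathSpechtInner η Y)
    (SemidirectProduct.inr σ)⁻¹ (innerPure η (fun i x => Pi.basis b (β (σ x)) i)
      fun i => spechtPolytabloid k (t' i)), ?_⟩
  rw [wreathSpechtEmb_mk, inv_inv]
  ext1 r
  rw [rowTensorRep_apply, innerMap_innerPure, map_smul, tensorPowerRep_tprod]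
  change _ = polyFun k (fun x => (β x).1) t r • tensorBasis b (Fin n) β
  congr 1
  · refine (prod_tabloidCoord_polytabloid k t' fun x => r (σ x)).trans ?_
    rw [h', ← polyFun_comp_perm k _ t σ]
    simp only [hσ]
  · rw [tensorBasis, Basis.piTensorProduct_apply]
    congr 1
    ext1 x
    simp only [SemidirectProduct.left_inr, SemidirectProduct.right_inr, Pi.one_apply, map_one,
      Module.End.one_apply]
    have h2 : η.blockIdx (σ⁻¹ x) = (β x).1 := by rw [← hσ]; simp
    rw [joinVec_of_eq η _ h2]
    have h3 : σ (σ⁻¹ x) = x := by simp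
    simp only [h3]
    rw [Pi.basis_apply, Pi.single_eq_same]

/-- The wreath product Specht module is cut out of the tensor power by the raising operators. -/
theorem range_wreathSpechtEmb :
    LinearMap.range (wreathSpechtEmb η Y b) = highestWeightTensor b η := by
  refine le_antisymm (range_wreathSpechtEmb_le η Y b) fun F hF => ?_
  have := Fintype.ofFinite (Fin n → Σ i, B i)
  have h1 : F = ∑ β, rowTensorSingle b β (rowCoord b β F) := by
    ext r
    rw [Finset.sum_apply]
    exact ((tensorBasis b (Fin n)).sum_repr (F r)).symm
  rw [h1]
  refine Submodule.sum_mem _ fun β _ => rowTensorSingle_mem_range η Y b ?_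
  rw [← highestWeight_eq_polySpan]
  exact (mem_highestWeightTensor b).1 hF β

end Induced

/-! ### Filtrations from families of maps -/

section FiltrationOfMaps

variable {k : Type*} [Field k] {H : Type*} [Group H] {V : Type*} [AddCommGroup V] [Module k V]
  {ρ : Representation k H V} {T : Type*} [AddCommGroup T] [Module k T] {τ : Representation k H T}

/-- The layer `N / N'` is identified with `σ` by an equivariant map `θ` with kernel `N'` on `N`
whose image is an embedded copy of `σ`. -/
lemma nonempty_sectionRep_equiv {W : Type*} [AddCommGroup W] [Module k W]
    {σ : Representation k H W} {N' N : Subrepresentation ρ}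
    {θ : V →ₗ[k] T} (hθ : ∀ h v, θ (ρ h v) = τ h (θ v))
    {ψ : W →ₗ[k] T} (hψ : ∀ h w, ψ (σ h w) = τ h (ψ w)) (hinj : Function.Injective ψ)
    (hmap : N.toSubmodule.map θ = LinearMap.range ψ)
    (hker : ∀ v ∈ N.toSubmodule, θ v = 0 ↔ v ∈ N'.toSubmodule) :
    Nonempty ((sectionRep N' N).Equiv σ) := by
  let q : N.toSubmodule →ₗ[k] LinearMap.range ψ :=
    (θ.domRestrict N.toSubmodule).codRestrict (LinearMap.range ψ) fun v => by
      rw [← hmap]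
      exact ⟨v.1, v.2, rfl⟩
  have hq : Function.Surjective q := by
    rintro ⟨x, hx⟩
    rw [← hmap] at hx
    obtain ⟨v, hv, rfl⟩ := hx
    exact ⟨⟨v, hv⟩, rfl⟩
  have hqker : N'.toSubmodule.submoduleOf N.toSubmodule = LinearMap.ker q := by
    ext v
    rw [LinearMap.mem_ker, ← Submodule.coe_eq_zero]
    exact (hker v.1 v.2).symm
  let e := (Submodule.quotEquivOfEq _ _ hqker).trans
    ((q.quotKerEquivOfSurjective hq).trans (LinearEquiv.ofInjective ψ hinj).symm)
  have he : ∀ v : N.toSubmodule, ψ (e (Submodule.Quotient.mk v)) = θ v.1 := by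
    intro v
    have h1 : e (Submodule.Quotient.mk v) = (LinearEquiv.ofInjective ψ hinj).symm (q v) := rfl
    rw [h1, ← LinearEquiv.ofInjective_apply (h := hinj), LinearEquiv.apply_symm_apply]
    rfl
  refine ⟨Representation.Equiv.mk e fun h => LinearMap.ext fun x => ?_⟩
  obtain ⟨v, rfl⟩ := Submodule.Quotient.mk_surjective _ x
  apply hinj
  change ψ (e (Submodule.Quotient.mk (N.toRepresentation h v))) =
    ψ (σ h (e (Submodule.Quotient.mk v)))
  rw [he, hψ, he, ← hθ]
  rfl

variable {ι : Type*} {W : ι → Type*} [∀ i, AddCommGroup (W i)] [∀ i, Module k (W i)]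
  {σ : ∀ i, Representation k H (W i)} {N : ℕ} {θ : Fin N → V →ₗ[k] T}
  {ψ : ∀ i, W i →ₗ[k] T} {f : Fin N → ι}

/-- The common kernel of the maps `θ l'` with `l ≤ l'`. -/
def tailKernel (hθ : ∀ l h v, θ l (ρ h v) = τ h (θ l v)) (l : ℕ) : Subrepresentation ρ where
  toSubmodule := ⨅ (l' : Fin N) (_ : l ≤ l'), LinearMap.ker (θ l')
  apply_mem_toSubmodule h v hv := by
    simp only [Submodule.mem_iInf, LinearMap.mem_ker] at hv ⊢
    intro l' hl'
    rw [hθ, hv l' hl', map_zero]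

lemma mem_tailKernel (hθ : ∀ l h v, θ l (ρ h v) = τ h (θ l v)) {l : ℕ} {v : V} :
    v ∈ (tailKernel hθ l).toSubmodule ↔ ∀ l' : Fin N, l ≤ l' → θ l' v = 0 := by
  simp [tailKernel]

/-- The filtration by the common kernels of the tails of a jointly injective family of maps. -/
def filtrationOfMaps (hθ : ∀ l h v, θ l (ρ h v) = τ h (θ l v))
    (hψ : ∀ i h w, ψ i (σ i h w) = τ h (ψ i w)) (hinj : ∀ i, Function.Injective (ψ i))
    (hbot : ∀ v, (∀ l, θ l v = 0) → v = 0)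
    (hlayer : ∀ l : Fin N, (tailKernel hθ (l + 1)).toSubmodule.map (θ l) = LinearMap.range (ψ (f l))) :
    Filtration ρ σ where
  length := N
  M l := tailKernel hθ l
  bottom := by
    rw [eq_bot_iff]
    intro v hv
    rw [mem_tailKernel] at hv
    exact hbot v fun l => hv l (Nat.zero_le _)
  top := by
    rw [eq_top_iff]
    intro v _
    rw [mem_tailKernel]
    intro l hl
    exact absurd l.2 (not_lt.2 hl)
  mono l l' hl v hv := by
    refine (mem_tailKernel hθ).2 fun l'' hl'' => ?_
    exact (mem_tailKernel hθ).1 hv l'' (le_trans hl hl'')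
  f := f
  layer l := by
    refine nonempty_sectionRep_equiv (hθ l) (hψ (f l)) (hinj (f l)) (hlayer l) fun v hv => ?_
    have hv := (mem_tailKernel hθ).1 hv
    rw [mem_tailKernel]
    constructor
    · intro h l' hl'
      rcases (show l ≤ l' from hl').eq_or_lt with rfl | hlt
      · exact h
      · exact hv l' hlt
    · intro h
      exact h l le_rfl

end FiltrationOfMaps

/-! ### Restriction of the last point -/

section LastCoord

variable {k : Type*} [Field k] {G : Type*} [Group G] {s n : ℕ} {V : Fin s → Type*}
  [∀ i, AddCommGroup (V i)] [∀ i, Module k (V i)]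
  {B : Fin s → Type*} (b : ∀ i, Module.Basis (B i) k (V i)) [∀ i, Finite (B i)]

/-- Contraction of the last tensor factor with a coordinate functional. -/
def contractLast (p : Σ i, B i) :
    (⨂[k] _ : Fin (n + 1), (∀ i, V i)) →ₗ[k] ⨂[k] _ : Fin n, (∀ i, V i) :=
  (tensorBasis b (Fin n)).equivFun.symm.toLinearMap ∘ₗ LinearMap.pi fun β =>
    (tensorBasis b (Fin (n + 1))).coord (Fin.snoc (α := fun _ => Σ i, B i) β p)

lemma repr_contractLast (p : Σ i, B i) (z : ⨂[k] _ : Fin (n + 1), (∀ i, V i))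
    (β : Fin n → Σ i, B i) : (tensorBasis b (Fin n)).repr (contractLast b p z) β =
      (tensorBasis b (Fin (n + 1))).repr z (Fin.snoc (α := fun _ => Σ i, B i) β p) := by
  rw [← Module.Basis.equivFun_apply]
  exact congrFun ((tensorBasis b (Fin n)).equivFun.apply_symm_apply _) β

lemma contractLast_tprod (p : Σ i, B i) (v : Fin (n + 1) → ∀ i, V i) :
    contractLast b p (PiTensorProduct.tprod k v) = (Pi.basis b).repr (v (Fin.last n)) p •
      PiTensorProduct.tprod k fun x : Fin n => v x.castSucc := by
  refine (tensorBasis b (Fin n)).ext_elem fun β => ?_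
  rw [repr_contractLast, map_smul, Finsupp.smul_apply, tensorBasis, tensorBasis,
    Basis.piTensorProduct_repr_tprod_apply, Basis.piTensorProduct_repr_tprod_apply,
    Fin.prod_univ_castSucc, smul_eq_mul, mul_comm]
  simp

lemma wreathEmb_right_castSucc (a : Wreath G (Fin n)) (x : Fin n) :
    (wreathEmb G n a).right x.castSucc = (a.right x).castSucc :=
  viaEmbedding_castSucc a.right x

lemma wreathEmb_right_last (a : Wreath G (Fin n)) :
    (wreathEmb G n a).right (Fin.last n) = Fin.last n :=
  viaEmbedding_last a.right

/-- An embedded element fixes the last point and has base component `1` there, so any functional on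
the last factor is invariant. This is why a whole basis of `Y_i` labels distinct layers. -/
lemma contractLast_tensorPowerRep (Y : ∀ i, Representation k G (V i)) (p : Σ i, B i)
    (a : Wreath G (Fin n)) (z : ⨂[k] _ : Fin (n + 1), (∀ i, V i)) :
    contractLast b p (tensorPowerRep (Fin (n + 1)) (sumRep Y) (wreathEmb G n a) z) =
      tensorPowerRep (Fin n) (sumRep Y) a (contractLast b p z) := by
  suffices h : contractLast b p ∘ₗ tensorPowerRep (Fin (n + 1)) (sumRep Y) (wreathEmb G n a) =
      tensorPowerRep (Fin n) (sumRep Y) a ∘ₗ contractLast b p from LinearMap.congr_fun h z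
  refine PiTensorProduct.ext (MultilinearMap.ext fun v => ?_)
  rw [LinearMap.compMultilinearMap_apply, LinearMap.compMultilinearMap_apply,
    LinearMap.comp_apply, LinearMap.comp_apply, tensorPowerRep_tprod, contractLast_tprod,
    contractLast_tprod, map_smul, tensorPowerRep_tprod]
  have h1 : (wreathEmb G n a).right⁻¹ (Fin.last n) = Fin.last n := by
    rw [Equiv.Perm.inv_eq_iff_eq, wreathEmb_right_last]
  have h2 : ∀ x : Fin n, (wreathEmb G n a).right⁻¹ x.castSucc = (a.right⁻¹ x).castSucc := by
    intro x
    rw [Equiv.Perm.inv_eq_iff_eq, wreathEmb_right_castSucc]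
    simp
  have h3 : (wreathEmb G n a).left (Fin.last n) = 1 := by simp [wreathEmb]
  have h4 : ∀ x : Fin n, (wreathEmb G n a).left x.castSucc = a.left x := by
    intro x; simp [wreathEmb]
  simp only [h1, h2, h3, h4, map_one, Module.End.one_apply]

/-- The part of a tensor in which the last point lies in row `j` and the last tensor factor is the
basis vector `p`. -/
def lastCoord (p : Σ i, B i) (j : ℕ) : RowTensor k V (Fin (n + 1)) →ₗ[k] RowTensor k V (Fin n) :=
  LinearMap.pi fun r => contractLast b p ∘ₗ LinearMap.proj (Fin.snoc (α := fun _ => ℕ) r j)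

lemma lastCoord_apply (p : Σ i, B i) (j : ℕ) (F : RowTensor k V (Fin (n + 1))) (r : Fin n → ℕ) :
    lastCoord b p j F r = contractLast b p (F (Fin.snoc (α := fun _ => ℕ) r j)) := rfl

lemma rowCoord_lastCoord (p : Σ i, B i) (j : ℕ) (F : RowTensor k V (Fin (n + 1)))
    (β : Fin n → Σ i, B i) : rowCoord b β (lastCoord b p j F) =
      slice j (rowCoord b (Fin.snoc (α := fun _ => Σ i, B i) β p) F) := by
  ext r
  exact repr_contractLast b p _ β

lemma lastCoord_rowTensorRep (Y : ∀ i, Representation k G (V i)) (p : Σ i, B i) (j : ℕ)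
    (a : Wreath G (Fin n)) (F : RowTensor k V (Fin (n + 1))) :
    lastCoord b p j (rowTensorRep (Fin (n + 1)) Y (wreathEmb G n a) F) =
      rowTensorRep (Fin n) Y a (lastCoord b p j F) := by
  ext1 r
  rw [lastCoord_apply, rowTensorRep_apply, rowTensorRep_apply, lastCoord_apply,
    contractLast_tensorPowerRep]
  congr 3
  ext x
  refine Fin.lastCases ?_ (fun x => ?_) x
  · rw [wreathEmb_right_last, Fin.snoc_last, Fin.snoc_last]
  · rw [wreathEmb_right_castSucc, Fin.snoc_castSucc, Fin.snoc_castSucc]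

lemma rowTensor_eq_zero_of_lastCoord {F : RowTensor k V (Fin (n + 1))}
    (h : ∀ p j, lastCoord b p j F = 0) : F = 0 := by
  refine rowTensor_ext b fun β => ?_
  rw [map_zero]
  refine eq_zero_of_slice_eq_zero fun j => ?_
  rw [← Fin.snoc_init_self β, ← rowCoord_lastCoord, h, map_zero]

end LastCoord

/-! ### Removal of boxes from multipartitions -/

section RemoveBox

lemma IsRemoveRow.row_unique {ι : Type*} [DecidableEq ι] {D' D : ι → YoungDiagram} {i : ι}
    {j j' : ℕ} (h : IsRemoveRow D' D i j) (h' : IsRemoveRow D' D i j') : j = j' := by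
  have h1 := h.rowLengths_eq i j
  rw [h'.rowLengths_eq i j] at h1
  by_contra hne
  simp [hne] at h1

lemma IsRemoveRow.unique {ι : Type*} [DecidableEq ι] {D' D'' D : ι → YoungDiagram} {i : ι} {j : ℕ}
    (h : IsRemoveRow D' D i j) (h' : IsRemoveRow D'' D i j) : D' = D'' := by
  ext1 i'
  refine eq_of_rowLengths_eq fun l => ?_
  have h1 := h.rowLengths_eq i' l
  rw [h'.rowLengths_eq i' l] at h1
  exact (Nat.add_right_cancel h1).symm

variable {s n : ℕ}

instance : Finite (Multipartition s n) := by
  refine Finite.of_injective (β := Fin s → Σ m : Fin (n + 1), PartitionOf m)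
    (fun η i => ⟨⟨(η.comp i).card, Nat.lt_succ_of_le ?_⟩, ⟨η.comp i, rfl⟩⟩) fun η η' h => ?_
  · exact (Finset.single_le_sum (f := fun i => (η.comp i).card) (fun _ _ => Nat.zero_le _)
      (Finset.mem_univ i)).trans_eq η.sum_card
  · refine Multipartition.ext (funext fun i => ?_)
    exact congrArg (fun x : Σ m : Fin (n + 1), PartitionOf m => x.2.diagram) (congrFun h i)

namespace Multipartition

lemma isRemoveBox_iff {del : Multipartition s n} {lam : Multipartition s (n + 1)} {i : Fin s} :
    del.IsRemoveBox lam i ↔ ∃ j, IsRemoveRow del.comp lam.comp i j := by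
  constructor
  · rintro ⟨⟨⟨j, l⟩, hc, hd⟩, hne⟩
    exact ⟨j, l, hc, hd, hne⟩
  · rintro ⟨j, l, hc, hd, hne⟩
    exact ⟨⟨(j, l), hc, hd⟩, hne⟩

/-- A component that loses a box is not left unchanged. Thus a multiplicity is the dimension of one
`Y_i` and never a sum of several. -/
lemma IsRemoveBox.eq {del : Multipartition s n} {lam : Multipartition s (n + 1)} {i i' : Fin s}
    (h : del.IsRemoveBox lam i) (h' : del.IsRemoveBox lam i') : i = i' := by
  by_contra hne
  obtain ⟨⟨c, hc, hd⟩, -⟩ := h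
  rw [h'.2 i hne] at hd
  rw [hd] at hc
  simp at hc

lemma exists_of_isRemoveRow {lam : Multipartition s (n + 1)} {D' : Fin s → YoungDiagram}
    {i : Fin s} {j : ℕ} (h : IsRemoveRow D' lam.comp i j) :
    ∃ del : Multipartition s n, del.comp = D' := by
  refine ⟨⟨D', ?_⟩, rfl⟩
  obtain ⟨l, hl, hD, hne⟩ := h
  have h1 := lam.sum_card
  rw [← Finset.add_sum_erase _ _ (Finset.mem_univ i)] at h1 ⊢
  rw [Finset.sum_congr rfl fun i' hi' => by rw [hne i' (Finset.ne_of_mem_erase hi')]]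
  have h2 : (D' i).card + 1 = (lam.comp i).card := by
    rw [YoungDiagram.card, hD, Finset.card_erase_add_one hl, YoungDiagram.card]
  omega

end Multipartition

end RemoveBox

/-! ### The layers of the filtration -/

section LayerIndex

variable {s n : ℕ} {B : Fin s → Type*}

variable (B) in
/-- The layers of the filtration: a multipartition obtained by removing a box from a component,
together with an element of the basis for this component. -/
abbrev LayerIndex (lam : Multipartition s (n + 1)) : Type _ :=
  Σ del : Multipartition s n, Σ i : {i // del.IsRemoveBox lam i}, B i.1

/-- The row from which a box is removed. -/
def LayerIndex.row {lam : Multipartition s (n + 1)} (a : LayerIndex B lam) : ℕ :=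
  (Multipartition.isRemoveBox_iff.1 a.2.1.2).choose

lemma LayerIndex.isRemoveRow {lam : Multipartition s (n + 1)} (a : LayerIndex B lam) :
    IsRemoveRow a.1.comp lam.comp a.2.1.1 a.row :=
  (Multipartition.isRemoveBox_iff.1 a.2.1.2).choose_spec

/-- The basis vector of a layer. -/
def LayerIndex.vec {lam : Multipartition s (n + 1)} (a : LayerIndex B lam) : Σ i, B i :=
  ⟨a.2.1.1, a.2.2⟩

lemma LayerIndex.exists_eq {lam : Multipartition s (n + 1)} {del : Multipartition s n}
    {p : Σ i, B i} {j : ℕ} (h : IsRemoveRow del.comp lam.comp p.1 j) :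
    ∃ a : LayerIndex B lam, a.vec = p ∧ a.row = j := by
  let a : LayerIndex B lam := ⟨del, ⟨p.1, Multipartition.isRemoveBox_iff.2 ⟨j, h⟩⟩, p.2⟩
  exact ⟨a, rfl, a.isRemoveRow.row_unique h⟩

/-- The row determines the removed box, as the last one of its row. Layers in the same row therefore
have different basis vectors, and they may be ordered arbitrarily among themselves. -/
lemma LayerIndex.ext {lam : Multipartition s (n + 1)} {a a' : LayerIndex B lam}
    (hv : a.vec = a'.vec) (hr : a.row = a'.row) : a = a' := by
  have h1 := a.isRemoveRow
  have h2 := a'.isRemoveRow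
  obtain ⟨del, ⟨i, hi⟩, x⟩ := a
  obtain ⟨del', ⟨i', hi'⟩, x'⟩ := a'
  obtain ⟨rfl, hx⟩ := Sigma.mk.inj_iff.1 hv
  obtain rfl := eq_of_heq hx
  rw [hr] at h1
  obtain rfl : del = del' := Multipartition.ext (h1.unique h2)
  rfl

end LayerIndex

/-! ### The branching rule -/

section Branching

variable {k : Type*} [Field k] {G : Type*} [Group G] {s n : ℕ} {V : Fin s → Type*}
  [∀ i, AddCommGroup (V i)] [∀ i, Module k (V i)] (Y : ∀ i, Representation k G (V i))
  {B : Fin s → Type*} (b : ∀ i, Module.Basis (B i) k (V i))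

lemma rowCoord_rowTensorSingle [DecidableEq (Fin n → Σ i, B i)] (β β' : Fin n → Σ i, B i)
    (H : (Fin n → ℕ) → k) :
    rowCoord b β (rowTensorSingle b β' H) = if β' = β then H else 0 := by
  ext r
  rw [rowCoord_apply]
  change (tensorBasis b (Fin n)).repr (H r • tensorBasis b (Fin n) β') β = _
  rw [map_smul, Module.Basis.repr_self, Finsupp.smul_apply, Finsupp.single_apply]
  split_ifs <;> simp

variable [∀ i, Finite (B i)]

lemma lastCoord_mem_highestWeightTensor {lam : Multipartition s (n + 1)}
    {del : Multipartition s n} {p : Σ i, B i} {j : ℕ}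
    (h : IsRemoveRow del.comp lam.comp p.1 j) {F : RowTensor k V (Fin (n + 1))}
    (hF : F ∈ highestWeightTensor b lam) (hj : lastCoord b p (j + 1) F = 0) :
    lastCoord b p j F ∈ highestWeightTensor b del := by
  rw [mem_highestWeightTensor]
  intro β
  rw [rowCoord_lastCoord]
  have h1 := (mem_highestWeightTensor b).1 hF (Fin.snoc (α := fun _ => Σ i, B i) β p)
  have h2 := slice_mem_highestWeight (j := j) (a' := rowLengths del.comp) (by
    simpa using h.rowLengths_eq) h1 (by rw [← rowCoord_lastCoord, hj, map_zero])
  simpa using h2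

/-- A highest weight tensor whose parts at all removable boxes in rows from `J` on vanish has no
parts in these rows. -/
lemma lastCoord_eq_zero {lam : Multipartition s (n + 1)} {F : RowTensor k V (Fin (n + 1))}
    (hF : F ∈ highestWeightTensor b lam) {p : Σ i, B i} {J : ℕ}
    (h : ∀ (del : Multipartition s n) (j : ℕ), J ≤ j → IsRemoveRow del.comp lam.comp p.1 j →
      lastCoord b p j F = 0) {j : ℕ} (hj : J ≤ j) : lastCoord b p j F = 0 := by
  refine rowTensor_ext b fun β => ?_
  rw [rowCoord_lastCoord, map_zero]
  have h1 := (mem_highestWeightTensor b).1 hF (Fin.snoc (α := fun _ => Σ i, B i) β p)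
  obtain ⟨J₀, hJ₀⟩ := exists_forall_slice_eq_zero h1
  -- This descends from `J₀`, with `d` bounding the distance: a slice that is nonzero just before a
  -- zero one would sit at a removable box, where the part vanishes by hypothesis.
  have key : ∀ d j, J ≤ j → J₀ ≤ j + d →
      slice j (rowCoord b (Fin.snoc (α := fun _ => Σ i, B i) β p) F) = 0 := by
    intro d
    induction d with
    | zero => exact fun j _ hj => hJ₀ j hj
    | succ d ih =>
      intro j hj hd
      by_contra h0
      obtain ⟨D', hD'⟩ := exists_isRemoveRow_of_slice_ne_zero h1
        (ih (j + 1) (by omega) (by omega)) h0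
      obtain ⟨del, rfl⟩ := Multipartition.exists_of_isRemoveRow hD'
      refine h0 ?_
      rw [← rowCoord_lastCoord, h del j hj (by simpa using hD'), map_zero]
  exact key J₀ j hj (Nat.le_add_left _ _)

/-- Every highest weight tensor of the smaller weight is the leading part of one of the larger
weight. -/
lemma exists_lastCoord_eq {lam : Multipartition s (n + 1)} {del : Multipartition s n}
    {p : Σ i, B i} {j : ℕ} (h : IsRemoveRow del.comp lam.comp p.1 j)
    {H : RowTensor k V (Fin n)} (hH : H ∈ highestWeightTensor b del) :
    ∃ F ∈ highestWeightTensor b lam, lastCoord b p j F = H ∧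
      ∀ p' j', (p' ≠ p ∨ j < j') → lastCoord b p' j' F = 0 := by
  classical
  have := Fintype.ofFinite (Fin n → Σ i, B i)
  have hex : ∀ β : Fin n → Σ i, B i, ∃ K ∈ polySpan k
      (fun x => (Fin.snoc (α := fun _ => Σ i, B i) β p x : Σ i, B i).1) lam.comp,
      slice j K = rowCoord b β H ∧ ∀ j' > j, slice j' K = 0 := by
    intro β
    refine exists_slice_eq_of_mem_polySpan (D' := del.comp) (by simpa using h) ?_
    rw [← highestWeight_eq_polySpan]
    simpa using (mem_highestWeightTensor b).1 hH β
  choose K hK hKj hK0 using hex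
  -- Each coefficient of `H` is lifted separately and `p` is attached as the last basis vector, so
  -- all parts for other basis vectors vanish.
  let F : RowTensor k V (Fin (n + 1)) :=
    ∑ β, rowTensorSingle b (Fin.snoc (α := fun _ => Σ i, B i) β p) (K β)
  have hcoord : ∀ p' j' β, rowCoord b β (lastCoord b p' j' F) =
      if p = p' then slice j' (K β) else 0 := by
    intro p' j' β
    simp only [rowCoord_lastCoord, F, map_sum, rowCoord_rowTensorSingle, Fin.snoc_inj]
    rw [Finset.sum_eq_single β]
    · by_cases hp : p = p' <;> simp [hp]
    · intro β' _ hne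
      simp [hne]
    · simp
  refine ⟨F, ?_, ?_, ?_⟩
  · refine Submodule.sum_mem _ fun β _ => (mem_highestWeightTensor b).2 fun β' => ?_
    rw [rowCoord_rowTensorSingle]
    split_ifs with hβ
    · subst hβ
      rw [highestWeight_eq_polySpan]
      exact hK β
    · exact zero_mem _
  · refine rowTensor_ext b fun β => ?_
    rw [hcoord, if_pos rfl, hKj]
  · intro p' j' hor
    refine rowTensor_ext b fun β => ?_
    rw [hcoord, map_zero]
    split_ifs with hp
    · exact hK0 β j' (hor.resolve_left fun hne => hne hp.symm)
    · rfl

/-- The branching rule: the restriction of `S^lam(Y_1, …, Y_s)` is filtered by the modules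
`S^del(Y_1, …, Y_s)` with `del` obtained by removing a box from the `i`-th component, each of them
occurring `dim Y_i` times. -/
theorem exists_filtration (b : ∀ i, Module.Basis (B i) k (V i)) (lam : Multipartition s (n + 1)) :
    ∃ Φ : Filtration ((wreathSpechtOf lam Y).comp (wreathEmb G n))
        (fun del : Multipartition s n => wreathSpechtOf del Y),
      ∀ del : Multipartition s n, Φ.multiplicity del =
        Nat.card (Σ i : {i // del.IsRemoveBox lam i}, B i.1) := by
  obtain ⟨N, ⟨e₀⟩⟩ := Finite.exists_equiv_fin (LayerIndex B lam)
  let g : Fin N → ℕ := fun l => (e₀.symm l).row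
  -- Layers are sorted by row so that vanishing of all later parts implies vanishing in every row
  -- strictly below that of the current layer. This makes the current part a leading one.
  let e : Fin N ≃ LayerIndex B lam := (Tuple.sort g).trans e₀.symm
  have hmono : Monotone fun l => (e l).row := Tuple.monotone_sort g
  let θ : Fin N → WreathSpechtSpace lam Y →ₗ[k] RowTensor k V (Fin n) := fun l =>
    lastCoord b (e l).vec (e l).row ∘ₗ wreathSpechtEmb lam Y b
  have hθ : ∀ l a u, θ l (((wreathSpechtOf lam Y).comp (wreathEmb G n)) a u) =
      rowTensorRep (Fin n) Y a (θ l u) := by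
    intro l a u
    change lastCoord b _ _ (wreathSpechtEmb lam Y b (wreathSpechtOf lam Y (wreathEmb G n a) u)) = _
    rw [wreathSpechtEmb_wreathSpechtOf, lastCoord_rowTensorRep]
    rfl
  have hmem : ∀ u, wreathSpechtEmb lam Y b u ∈ highestWeightTensor b lam := fun u =>
    range_wreathSpechtEmb_le lam Y b ⟨u, rfl⟩
  have hbot : ∀ u, (∀ l, θ l u = 0) → u = 0 := by
    intro u hu
    refine (injective_iff_map_eq_zero _).1 (wreathSpechtEmb_injective lam Y b) u ?_
    refine rowTensor_eq_zero_of_lastCoord b fun p j =>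
      lastCoord_eq_zero b (hmem u) (J := 0) (fun del j' _ h => ?_) (Nat.zero_le j)
    obtain ⟨a, rfl, rfl⟩ := LayerIndex.exists_eq h
    simpa [θ] using hu (e.symm a)
  have hlayer : ∀ l : Fin N, (tailKernel hθ (l + 1)).toSubmodule.map (θ l) =
      LinearMap.range (wreathSpechtEmb (e l).1 Y b) := by
    intro l
    rw [range_wreathSpechtEmb]
    refine le_antisymm ?_ fun H hH => ?_
    · rintro _ ⟨u, hu, rfl⟩
      have hu := (mem_tailKernel hθ).1 hu
      refine lastCoord_mem_highestWeightTensor b (e l).isRemoveRow (hmem u) ?_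
      refine lastCoord_eq_zero b (hmem u) (fun del j' hj' h => ?_) le_rfl
      obtain ⟨a, hv, rfl⟩ := LayerIndex.exists_eq h
      rw [← hv]
      -- A removable box in a strictly larger row is indexed later, hence its part is already zero
      -- on this tail kernel.
      have hlt : l < e.symm a := by
        by_contra hle
        have := hmono (not_lt.1 hle)
        simp only [Equiv.apply_symm_apply] at this
        omega
      simpa [θ] using hu (e.symm a) hlt
    · obtain ⟨F, hF, hFH, hF0⟩ := exists_lastCoord_eq b (e l).isRemoveRow (p := (e l).vec) hH
      rw [← range_wreathSpechtEmb lam Y b] at hF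
      obtain ⟨u, rfl⟩ := hF
      -- A later layer has a different basis vector or a strictly larger row, and the lift has no
      -- part in either case.
      refine ⟨u, (mem_tailKernel hθ).2 fun l' hl' => hF0 _ _ ?_, hFH⟩
      have hlt : l < l' := hl'
      by_contra hcon
      push Not at hcon
      have h1 := LayerIndex.ext hcon.1 (le_antisymm hcon.2 (hmono hlt.le))
      exact hlt.ne' (e.injective h1)
  refine ⟨filtrationOfMaps (f := fun l => (e l).1) hθ
    (fun del => wreathSpechtEmb_wreathSpechtOf del Y b)
    (fun del => wreathSpechtEmb_injective del Y b) hbot hlayer, fun del => ?_⟩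
  refine Nat.card_congr ?_
  exact (e.subtypeEquiv (q := fun a : LayerIndex B lam => a.1 = del) fun l => Iff.rfl).trans
    (Equiv.sigmaSubtype del)

end Branching

/-! ### Specialisation to the Specht modules of `S_m` -/

instance (X : Type*) [Fintype X] [DecidableEq X] (lam : YoungDiagram) (k : Type*) [Field k] :
    Module.Finite k (SpechtModule X lam k) :=
  Module.Finite.span_of_finite k (Set.finite_range _)

end WreathSpecht

end

theorem mainTheorem2 (k : Type*) [Field k] (m n : ℕ)
    (lam : WreathSpecht.Multipartition (WreathSpecht.numPartitions m) (n + 1)) :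
    ∃ Φ : WreathSpecht.Filtration
        ((WreathSpecht.wreathSpecht k m lam).comp
          (WreathSpecht.wreathEmb (Equiv.Perm (Fin m)) n))
        (fun del : WreathSpecht.Multipartition (WreathSpecht.numPartitions m) n =>
          WreathSpecht.wreathSpecht k m del),
      ∀ del : WreathSpecht.Multipartition (WreathSpecht.numPartitions m) n,
        (∀ i, del.IsRemoveBox lam i →
          Φ.multiplicity del =
            Module.finrank k (WreathSpecht.SpechtModule (Fin m) (WreathSpecht.mu m i) k)) ∧
        ((¬ ∃ i, del.IsRemoveBox lam i) → Φ.multiplicity del = 0) := by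
  obtain ⟨Φ, hΦ⟩ := WreathSpecht.exists_filtration
    (fun i => WreathSpecht.spechtRep (Fin m) (WreathSpecht.mu m i) k)
    (fun i => Module.finBasis k (WreathSpecht.SpechtModule (Fin m) (WreathSpecht.mu m i) k)) lam
  refine ⟨Φ, fun del => ⟨fun i hi => ?_, fun hno => ?_⟩⟩
  · refine (hΦ del).trans ?_
    -- Only one component can have lost a box, so the layers labelled `del` correspond to a basis of
    -- a single Specht module.
    have : Unique {i // del.IsRemoveBox lam i} :=
      ⟨⟨⟨i, hi⟩⟩, fun i' => Subtype.ext (i'.2.eq hi)⟩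
    rw [Nat.card_congr (Equiv.uniqueSigma _), Nat.card_eq_fintype_card, Fintype.card_fin]
    rw [Subsingleton.elim (default : {i // del.IsRemoveBox lam i}) ⟨i, hi⟩]
  · refine (hΦ del).trans ?_
    have : IsEmpty {i // del.IsRemoveBox lam i} := ⟨fun i => hno ⟨i.1, i.2⟩⟩
    exact Nat.card_of_isEmpty
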